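/- For an axis-parallel rectangle $K=[x_c-h_x,x_c+h_x]\times[y_c-h_y,y_c+h_y]$ with $h_x,h_y>0$, let $a_1,a_2,a_3,a_4$ be its lower left, upper left, upper right and lower right vertices, let $e_1,e_2,e_3,e_4$ be its lower, left, upper and right edges, with outward unit normals $n_{e_j}$, and put $s=(x-x_c)/h_x$, $t=(y-y_c)/h_y$, $$p_1^-=\tfrac18[2(1-s)(1-t)-s-t],\quad p_2^-=\tfrac18[2(1-s)(1+t)-s+t],\quad p_3^-=\tfrac18[2(1+s)(1+t)+s+t],\quad p_4^-=\tfrac18[2(1+s)(1-t)+s-t],$$ $$q_1^-=-\tfrac{h_y}4(-t^2-t+1),\quad q_2^-=-\tfrac{h_x}4(-s^2-s+1),\quad q_3^-=\tfrac{h_y}4(t^2-t-1),\quad q_4^-=\tfrac{h_x}4(s^2-s-1).$$ For $v\in H^2(K)$ the reduced Morley interpolant is $$\Pi_K^-v=\sum_{i=1}^4 v(a_i)\,p_i^-+\sum_{j=1}^4\Big(\frac1{|e_j|}\int_{e_j}\frac{\partial v}{\partial n_{e_j}}\,ds\Big)q_j^-,$$ where the values $v(a_i)$ are those of the representative of $v$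 that is continuous on $K$, and the first derivatives of $v$ on the edges are traces. There is a constant $C>0$ such that the following holds for every such rectangle $K$; here derivatives are weak derivatives and $\|\cdot\|=\|\cdot\|_{L^2(K)}$. (a) For every $v\in H^2(K)$ one has $v-\Pi_K^-v\in H^2(K)$ and $$\Big\|\frac{\partial(v-\Pi_K^-v)}{\partial x}\Big\|\le C\Big(h_x\Big\|\frac{\partial^2v}{\partial x^2}\Big\|+h_y\Big\|\frac{\partial^2v}{\partial x\partial y}\Big\|\Big),\qquad \Big\|\frac{\partial(v-\Pi_K^-v)}{\partial y}\Big\|\le C\Big(h_x\Big\|\frac{\partial^2v}{\partial x\partial y}\Big\|+h_y\Big\|\frac{\partial^2v}{\partial y^2}\Big\|\Big).$$ (b) For every $v\in H^3(K)$ one has $v-\Pi_K^-v\in H^3(K)$ and $$\Big\|\frac{\partial(v-\Pi_K^-v)}{\partial x}\Big\|\le C\Big(h_x^2\Big\|\frac{\partial^3v}{\partial x^3}\Big\|+h_xh_y\Big\|\frac{\partial^3v}{\partial x^2\partial y}\Big\|+h_y^2\Big\|\frac{\partial^3v}{\partial x\partial y^2}\Big\|\Big),$$ $$\Big\|\frac{\partial(v-\Pi_K^-v)}{\partial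 y}\Big\|\le C\Big(h_x^2\Big\|\frac{\partial^3v}{\partial x^2\partial y}\Big\|+h_xh_y\Big\|\frac{\partial^3v}{\partial x\partial y^2}\Big\|+h_y^2\Big\|\frac{\partial^3v}{\partial y^3}\Big\|\Big),$$ $$\Big\|\frac{\partial^2(v-\Pi_K^-v)}{\partial x^2}\Big\|\le C\Big(h_x\Big\|\frac{\partial^3v}{\partial x^3}\Big\|+h_y\Big\|\frac{\partial^3v}{\partial x^2\partial y}\Big\|\Big),$$ $$\Big\|\frac{\partial^2(v-\Pi_K^-v)}{\partial x\partial y}\Big\|\le C\Big(h_x\Big\|\frac{\partial^3v}{\partial x^2\partial y}\Big\|+h_y\Big\|\frac{\partial^3v}{\partial x\partial y^2}\Big\|\Big),$$ $$\Big\|\frac{\partial^2(v-\Pi_K^-v)}{\partial y^2}\Big\|\le C\Big(h_x\Big\|\frac{\partial^3v}{\partial x\partial y^2}\Big\|+h_y\Big\|\frac{\partial^3v}{\partial y^3}\Big\|\Big).$$ -/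

import Mathlib

open MeasureTheory
open scoped ContDiff

namespace ReducedMorley

/-- Partial derivative in the first variable of a differentiable function on the plane. -/
noncomputable def pdx (φ : ℝ × ℝ → ℝ) : ℝ × ℝ → ℝ := fun p => fderiv ℝ φ p (1, 0)

/-- Partial derivative in the second variable of a differentiable function on the plane. -/
noncomputable def pdy (φ : ℝ × ℝ → ℝ) : ℝ × ℝ → ℝ := fun p => fderiv ℝ φ p (0, 1)

/-- `g` is the weak derivative `∂^{i+j} u / ∂x^i ∂y^j` of `u` on the open set `U`, tested against all
smooth functions with compact support in `U`. -/
def IsWeakDeriv (U : Set (ℝ × ℝ)) (i j : ℕ) (u g : ℝ × ℝ → ℝ) : Prop :=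
  LocallyIntegrableOn u U volume ∧ LocallyIntegrableOn g U volume ∧
    ∀ φ : ℝ × ℝ → ℝ, ContDiff ℝ ∞ φ → HasCompactSupport φ → tsupport φ ⊆ U →
      ∫ p in U, u p * (pdx^[i] (pdy^[j] φ)) p = (-1 : ℝ) ^ (i + j) * ∫ p in U, g p * φ p

open Classical in
/-- The weak derivative `∂^{i+j} u / ∂x^i ∂y^j` on `U`; it is determined up to a null set of `U`
(and is set to `0` if there is none). -/
noncomputable def weakDeriv (U : Set (ℝ × ℝ)) (i j : ℕ) (u : ℝ × ℝ → ℝ) : ℝ × ℝ → ℝ :=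
  if h : ∃ g, IsWeakDeriv U i j u g then h.choose else 0

/-- The Sobolev space `H^k(U)`: all weak derivatives of order at most `k` exist and are
square integrable on `U`. Functions that agree almost everywhere on `U` are not distinguished. -/
def MemH (U : Set (ℝ × ℝ)) (k : ℕ) (u : ℝ × ℝ → ℝ) : Prop :=
  MemLp u 2 (volume.restrict U) ∧
    ∀ i j : ℕ, i + j ≤ k → ∃ g, IsWeakDeriv U i j u g ∧ MemLp g 2 (volume.restrict U)

/-- The norm of `L²(U)`. -/
noncomputable def l2norm (U : Set (ℝ × ℝ)) (f : ℝ × ℝ → ℝ) : ℝ :=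
  (eLpNorm f 2 (volume.restrict U)).toReal

/-- An axis-parallel rectangle with centre `(xc, yc)` and dimensions `2 hx × 2 hy`. -/
structure Rect where
  xc : ℝ
  yc : ℝ
  hx : ℝ
  hy : ℝ
  hx_pos : 0 < hx
  hy_pos : 0 < hy

namespace Rect

/-- The closed rectangle. -/
def closed (K : Rect) : Set (ℝ × ℝ) :=
  Set.Icc (K.xc - K.hx) (K.xc + K.hx) ×ˢ Set.Icc (K.yc - K.hy) (K.yc + K.hy)

/-- The open rectangle. -/
def inner (K : Rect) : Set (ℝ × ℝ) :=
  Set.Ioo (K.xc - K.hx) (K.xc + K.hx) ×ˢ Set.Ioo (K.yc - K.hy) (K.yc + K.hy)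

/-- The vertices `a₁, a₂, a₃, a₄`, clockwise from the lower left one. -/
noncomputable def vertex (K : Rect) : Fin 4 → ℝ × ℝ :=
  ![(K.xc - K.hx, K.yc - K.hy), (K.xc - K.hx, K.yc + K.hy),
    (K.xc + K.hx, K.yc + K.hy), (K.xc + K.hx, K.yc - K.hy)]

open Classical in
/-- The representative of (the almost-everywhere class of) `v` that is continuous on the closed
rectangle; its values there are determined by the class (and it is set to `0` if there is none). -/
noncomputable def contRep (K : Rect) (v : ℝ × ℝ → ℝ) : ℝ × ℝ → ℝ :=
  if h : ∃ w : ℝ × ℝ → ℝ, ContinuousOn w K.closed ∧ w =ᵐ[volume.restrict K.inner] v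
  then h.choose else 0

/-- `τ` is the boundary trace of `w ∈ H¹(K)`: it is square integrable on each of the four edges, and
Green's formula holds, with boundary values `τ`, in both coordinate directions against every
function that is smooth up to the boundary. This determines `τ` almost everywhere on each edge. -/
def IsTrace (K : Rect) (w τ : ℝ × ℝ → ℝ) : Prop :=
  MemLp (fun x => τ (x, K.yc - K.hy)) 2
    (volume.restrict (Set.Ioo (K.xc - K.hx) (K.xc + K.hx))) ∧
  MemLp (fun y => τ (K.xc - K.hx, y)) 2
    (volume.restrict (Set.Ioo (K.yc - K.hy) (K.yc + K.hy))) ∧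
  MemLp (fun x => τ (x, K.yc + K.hy)) 2
    (volume.restrict (Set.Ioo (K.xc - K.hx) (K.xc + K.hx))) ∧
  MemLp (fun y => τ (K.xc + K.hx, y)) 2
    (volume.restrict (Set.Ioo (K.yc - K.hy) (K.yc + K.hy))) ∧
  ∀ φ : ℝ × ℝ → ℝ, ContDiff ℝ ∞ φ →
    ((∫ p in K.inner, w p * pdx φ p) + (∫ p in K.inner, weakDeriv K.inner 1 0 w p * φ p)
        = (∫ y in (K.yc - K.hy)..(K.yc + K.hy), τ (K.xc + K.hx, y) * φ (K.xc + K.hx, y))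
          - ∫ y in (K.yc - K.hy)..(K.yc + K.hy), τ (K.xc - K.hx, y) * φ (K.xc - K.hx, y)) ∧
    ((∫ p in K.inner, w p * pdy φ p) + (∫ p in K.inner, weakDeriv K.inner 0 1 w p * φ p)
        = (∫ x in (K.xc - K.hx)..(K.xc + K.hx), τ (x, K.yc + K.hy) * φ (x, K.yc + K.hy))
          - ∫ x in (K.xc - K.hx)..(K.xc + K.hx), τ (x, K.yc - K.hy) * φ (x, K.yc - K.hy))

open Classical in
/-- The boundary trace of `w ∈ H¹(K)` (set to `0` if there is none). -/
noncomputable def trace (K : Rect) (w : ℝ × ℝ → ℝ) : ℝ × ℝ → ℝ :=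
  if h : ∃ τ, K.IsTrace w τ then h.choose else 0

/-- The means `(1/|e_j|) ∫_{e_j} ∂v/∂n_{e_j} ds` of the outward normal derivative of `v ∈ H²(K)` over
the lower, left, upper and right edge; on the edges the first derivatives of `v` are traces. -/
noncomputable def normalMean (K : Rect) (v : ℝ × ℝ → ℝ) : Fin 4 → ℝ :=
  ![1 / (2 * K.hx) * ∫ x in (K.xc - K.hx)..(K.xc + K.hx),
      -K.trace (weakDeriv K.inner 0 1 v) (x, K.yc - K.hy),
    1 / (2 * K.hy) * ∫ y in (K.yc - K.hy)..(K.yc + K.hy),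
      -K.trace (weakDeriv K.inner 1 0 v) (K.xc - K.hx, y),
    1 / (2 * K.hx) * ∫ x in (K.xc - K.hx)..(K.xc + K.hx),
      K.trace (weakDeriv K.inner 0 1 v) (x, K.yc + K.hy),
    1 / (2 * K.hy) * ∫ y in (K.yc - K.hy)..(K.yc + K.hy),
      K.trace (weakDeriv K.inner 1 0 v) (K.xc + K.hx, y)]

/-- The reduced basis functions `p₁⁻, …, p₄⁻`. -/
noncomputable def pRed (K : Rect) (z : ℝ × ℝ) : Fin 4 → ℝ :=
  let s := (z.1 - K.xc) / K.hx
  let t := (z.2 - K.yc) / K.hy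
  ![1 / 8 * (2 * (1 - s) * (1 - t) - s - t),
    1 / 8 * (2 * (1 - s) * (1 + t) - s + t),
    1 / 8 * (2 * (1 + s) * (1 + t) + s + t),
    1 / 8 * (2 * (1 + s) * (1 - t) + s - t)]

/-- The reduced basis functions `q₁⁻, …, q₄⁻`. -/
noncomputable def qRed (K : Rect) (z : ℝ × ℝ) : Fin 4 → ℝ :=
  let s := (z.1 - K.xc) / K.hx
  let t := (z.2 - K.yc) / K.hy
  ![-(K.hy / 4) * (-t ^ 2 - t + 1),
    -(K.hx / 4) * (-s ^ 2 - s + 1),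
    K.hy / 4 * (t ^ 2 - t - 1),
    K.hx / 4 * (s ^ 2 - s - 1)]

/-- The reduced Morley interpolant `Π_K⁻ v` of `v ∈ H²(K)`. -/
noncomputable def interp (K : Rect) (v : ℝ × ℝ → ℝ) : ℝ × ℝ → ℝ := fun z =>
  ∑ i, K.contRep v (K.vertex i) * K.pRed z i + ∑ j, K.normalMean v j * K.qRed z j

/-- The `L²(K)` norm of the weak derivative `∂^{i+j} u / ∂x^i ∂y^j` on the rectangle. -/
noncomputable def dnorm (K : Rect) (i j : ℕ) (u : ℝ × ℝ → ℝ) : ℝ :=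
  l2norm K.inner (weakDeriv K.inner i j u)

end Rect

end ReducedMorley

namespace ReducedMorley

theorem contDiff_pdx {φ : ℝ × ℝ → ℝ} (h : ContDiff ℝ ∞ φ) : ContDiff ℝ ∞ (pdx φ) :=
  (h.fderiv_right (m := ∞) (by simp)).clm_apply contDiff_const

theorem contDiff_pdy {φ : ℝ × ℝ → ℝ} (h : ContDiff ℝ ∞ φ) : ContDiff ℝ ∞ (pdy φ) :=
  (h.fderiv_right (m := ∞) (by simp)).clm_apply contDiff_const

theorem pdx_pdy_comm {φ : ℝ × ℝ → ℝ} (h : ContDiff ℝ ∞ φ) : pdx (pdy φ) = pdy (pdx φ) := by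
  have h2 : Differentiable ℝ (fderiv ℝ φ) :=
    (h.fderiv_right (m := ∞) (by simp)).differentiable (by simp)
  funext p
  have hs : IsSymmSndFDerivAt ℝ φ p :=
    h.contDiffAt.isSymmSndFDerivAt (by simp; exact WithTop.coe_le_coe.2 le_top)
  have key : ∀ v w : ℝ × ℝ,
      fderiv ℝ (fun q => fderiv ℝ φ q v) p w = fderiv ℝ (fderiv ℝ φ) p w v := by
    intro v w
    rw [fderiv_clm_apply (h2 p) (differentiableAt_const v)]
    simp
  change fderiv ℝ (fun q => fderiv ℝ φ q (0, 1)) p (1, 0)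
    = fderiv ℝ (fun q => fderiv ℝ φ q (1, 0)) p (0, 1)
  rw [key, key, hs.eq]

theorem contDiff_iterate_pdx {φ : ℝ × ℝ → ℝ} (h : ContDiff ℝ ∞ φ) (i : ℕ) :
    ContDiff ℝ ∞ (pdx^[i] φ) := by
  induction i with
  | zero => exact h
  | succ n ih => rw [Function.iterate_succ_apply']; exact contDiff_pdx ih

theorem contDiff_iterate_pdy {φ : ℝ × ℝ → ℝ} (h : ContDiff ℝ ∞ φ) (i : ℕ) :
    ContDiff ℝ ∞ (pdy^[i] φ) := by
  induction i with
  | zero => exact h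
  | succ n ih => rw [Function.iterate_succ_apply']; exact contDiff_pdy ih

theorem iterate_pdy_pdx_comm {φ : ℝ × ℝ → ℝ} (h : ContDiff ℝ ∞ φ) (j : ℕ) :
    pdy^[j] (pdx φ) = pdx (pdy^[j] φ) := by
  induction j with
  | zero => rfl
  | succ n ih =>
    rw [Function.iterate_succ_apply', ih, Function.iterate_succ_apply',
      pdx_pdy_comm (contDiff_iterate_pdy h n)]

/-- Smooth functions with compact support in `U`. -/
structure IsTest (U : Set (ℝ × ℝ)) (φ : ℝ × ℝ → ℝ) : Prop where
  contDiff : ContDiff ℝ ∞ φ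
  hasCompactSupport : HasCompactSupport φ
  tsupport_subset : tsupport φ ⊆ U

namespace IsTest

variable {U : Set (ℝ × ℝ)} {φ : ℝ × ℝ → ℝ}

theorem pdx (h : IsTest U φ) : IsTest U (pdx φ) :=
  ⟨contDiff_pdx h.1, h.2.fderiv_apply ℝ _, (tsupport_fderiv_apply_subset ℝ _).trans h.3⟩

theorem pdy (h : IsTest U φ) : IsTest U (pdy φ) :=
  ⟨contDiff_pdy h.1, h.2.fderiv_apply ℝ _, (tsupport_fderiv_apply_subset ℝ _).trans h.3⟩

theorem iterate_pdx (h : IsTest U φ) (i : ℕ) : IsTest U (ReducedMorley.pdx^[i] φ) := by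
  induction i with
  | zero => exact h
  | succ n ih => rw [Function.iterate_succ_apply']; exact ih.pdx

theorem iterate_pdy (h : IsTest U φ) (i : ℕ) : IsTest U (ReducedMorley.pdy^[i] φ) := by
  induction i with
  | zero => exact h
  | succ n ih => rw [Function.iterate_succ_apply']; exact ih.pdy

theorem continuous (h : IsTest U φ) : Continuous φ := h.1.continuous

theorem eq_zero (h : IsTest U φ) {p : ℝ × ℝ} (hp : p ∉ U) : φ p = 0 := by
  by_contra h0
  exact hp (h.3 (subset_tsupport _ h0))

theorem setIntegral_mul (h : IsTest U φ) (u : ℝ × ℝ → ℝ) :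
    ∫ p in U, u p * φ p = ∫ p, u p * φ p :=
  setIntegral_eq_integral_of_forall_compl_eq_zero fun p hp => by rw [h.eq_zero hp, mul_zero]

theorem integrable_mul (h : IsTest U φ) {u : ℝ × ℝ → ℝ} (hu : LocallyIntegrableOn u U volume) :
    IntegrableOn (fun p => u p * φ p) U := by
  have h1 : IntegrableOn u (tsupport φ) :=
    hu.integrableOn_compact_subset h.3 h.2
  have h2 : IntegrableOn (fun p => u p * φ p) (tsupport φ) :=
    h1.mul_continuousOn h.continuous.continuousOn h.2
  have h3 : Integrable (fun p => u p * φ p) := by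
    refine (integrableOn_iff_integrable_of_support_subset ?_).1 h2
    intro p hp
    exact subset_tsupport _ (right_ne_zero_of_mul hp)
  exact h3.integrableOn

end IsTest

variable {U : Set (ℝ × ℝ)} {u v g f : ℝ × ℝ → ℝ} {i j : ℕ}

theorem IsWeakDeriv.ae_eq (hU : IsOpen U) (h : IsWeakDeriv U i j u g) (h' : IsWeakDeriv U i j u f) :
    g =ᵐ[volume.restrict U] f := by
  have h0 : ∀ᵐ p ∂volume, p ∈ U → (g - f) p = 0 := by
    refine hU.ae_eq_zero_of_integral_contDiff_smul_eq_zero (h.2.1.sub h'.2.1) ?_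
    intro φ h1 h2 h3
    have ht : IsTest U φ := ⟨h1, h2, h3⟩
    have e1 := h.2.2 φ h1 h2 h3
    have e2 := h'.2.2 φ h1 h2 h3
    have e3 : ∫ p in U, g p * φ p = ∫ p in U, f p * φ p := by
      have hne : (-1 : ℝ) ^ (i + j) ≠ 0 := by positivity
      exact mul_left_cancel₀ hne (e1.symm.trans e2)
    have e4 : ∫ p in U, (g - f) p * φ p = 0 := by
      simp only [Pi.sub_apply, sub_mul]
      rw [integral_sub (ht.integrable_mul h.2.1) (ht.integrable_mul h'.2.1), e3, sub_self]
    rw [ht.setIntegral_mul] at e4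
    simpa [mul_comm] using e4
  filter_upwards [(ae_restrict_iff' hU.measurableSet).2 h0] with p hp
  exact sub_eq_zero.1 hp

theorem IsWeakDeriv.weakDeriv (h : IsWeakDeriv U i j u g) :
    IsWeakDeriv U i j u (weakDeriv U i j u) := by
  have hex : ∃ g, IsWeakDeriv U i j u g := ⟨g, h⟩
  rw [ReducedMorley.weakDeriv, dif_pos hex]
  exact hex.choose_spec

theorem IsWeakDeriv.weakDeriv_ae_eq (hU : IsOpen U) (h : IsWeakDeriv U i j u g) :
    ReducedMorley.weakDeriv U i j u =ᵐ[volume.restrict U] g :=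
  h.weakDeriv.ae_eq hU h

theorem IsWeakDeriv.sub (h : IsWeakDeriv U i j u g) (h' : IsWeakDeriv U i j v f) :
    IsWeakDeriv U i j (u - v) (g - f) := by
  refine ⟨h.1.sub h'.1, h.2.1.sub h'.2.1, fun φ h1 h2 h3 => ?_⟩
  have ht : IsTest U φ := ⟨h1, h2, h3⟩
  have ht' := (ht.iterate_pdy j).iterate_pdx i
  simp only [Pi.sub_apply, sub_mul]
  rw [integral_sub (ht'.integrable_mul h.1) (ht'.integrable_mul h'.1),
    integral_sub (ht.integrable_mul h.2.1) (ht.integrable_mul h'.2.1), h.2.2 φ h1 h2 h3,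
    h'.2.2 φ h1 h2 h3, mul_sub]

/-- The weak derivative in `x` of a weak derivative. -/
theorem IsWeakDeriv.pdx_of_succ (h : IsWeakDeriv U i j u g) (h' : IsWeakDeriv U (i + 1) j u f) :
    IsWeakDeriv U 1 0 g f := by
  refine ⟨h.2.1, h'.2.1, fun φ h1 h2 h3 => ?_⟩
  have ht : IsTest U φ := ⟨h1, h2, h3⟩
  have e1 := h.2.2 _ ht.pdx.1 ht.pdx.2 ht.pdx.3
  have e2 := h'.2.2 φ h1 h2 h3
  rw [iterate_pdy_pdx_comm h1, ← Function.iterate_succ_apply, e2] at e1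
  have hne : (-1 : ℝ) ^ (i + j) ≠ 0 := by positivity
  refine mul_left_cancel₀ hne ?_
  simp only [Function.iterate_one, Function.iterate_zero, id, ← e1]
  ring

/-- The weak derivative in `y` of a weak derivative. -/
theorem IsWeakDeriv.pdy_of_succ (h : IsWeakDeriv U i j u g) (h' : IsWeakDeriv U i (j + 1) u f) :
    IsWeakDeriv U 0 1 g f := by
  refine ⟨h.2.1, h'.2.1, fun φ h1 h2 h3 => ?_⟩
  have ht : IsTest U φ := ⟨h1, h2, h3⟩
  have e1 := h.2.2 _ ht.pdy.1 ht.pdy.2 ht.pdy.3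
  have e2 := h'.2.2 φ h1 h2 h3
  rw [← Function.iterate_succ_apply, e2] at e1
  have hne : (-1 : ℝ) ^ (i + j) ≠ 0 := by positivity
  refine mul_left_cancel₀ hne ?_
  simp only [Function.iterate_one, Function.iterate_zero, id, ← e1]
  ring

theorem IsTest.integral_mul_fderiv {φ : ℝ × ℝ → ℝ} (ht : IsTest U φ) (hu : ContDiff ℝ ∞ u)
    (e : ℝ × ℝ) : ∫ p, u p * fderiv ℝ φ p e = -∫ p, fderiv ℝ u p e * φ p := by
  have hu' : Continuous fun p => fderiv ℝ u p e :=
    ((hu.fderiv_right (m := ∞) (by simp)).clm_apply contDiff_const).continuous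
  have hφ' : Continuous fun p => fderiv ℝ φ p e :=
    ((ht.1.fderiv_right (m := ∞) (by simp)).clm_apply contDiff_const).continuous
  apply integral_mul_fderiv_eq_neg_fderiv_mul_of_integrable
  · exact (hu'.mul ht.continuous).integrable_of_hasCompactSupport ht.2.mul_left
  · exact (hu.continuous.mul hφ').integrable_of_hasCompactSupport (ht.2.fderiv_apply ℝ e).mul_left
  · exact (hu.continuous.mul ht.continuous).integrable_of_hasCompactSupport ht.2.mul_left
  · exact fun x _ => hu.differentiable (by simp) x
  · exact fun x _ => ht.1.differentiable (by simp) x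

theorem integral_mul_iterate_pdx (i : ℕ) : ∀ {u φ : ℝ × ℝ → ℝ}, IsTest U φ →
    ContDiff ℝ ∞ u → ∫ p, u p * (pdx^[i] φ) p = (-1) ^ i * ∫ p, (pdx^[i] u) p * φ p := by
  induction i with
  | zero => intro u φ _ _; simp
  | succ n ih =>
    intro u φ ht hu
    rw [Function.iterate_succ_apply, ih ht.pdx hu]
    have h := ht.integral_mul_fderiv (contDiff_iterate_pdx hu n) (1, 0)
    rw [Function.iterate_succ_apply']
    change _ * ∫ p, (pdx^[n] u) p * fderiv ℝ φ p (1, 0) = _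
    rw [h, pow_succ]
    simp only [pdx, mul_neg, neg_mul, mul_one]

theorem integral_mul_iterate_pdy (i : ℕ) : ∀ {u φ : ℝ × ℝ → ℝ}, IsTest U φ →
    ContDiff ℝ ∞ u → ∫ p, u p * (pdy^[i] φ) p = (-1) ^ i * ∫ p, (pdy^[i] u) p * φ p := by
  induction i with
  | zero => intro u φ _ _; simp
  | succ n ih =>
    intro u φ ht hu
    rw [Function.iterate_succ_apply, ih ht.pdy hu]
    have h := ht.integral_mul_fderiv (contDiff_iterate_pdy hu n) (0, 1)
    rw [Function.iterate_succ_apply']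
    change _ * ∫ p, (pdy^[n] u) p * fderiv ℝ φ p (0, 1) = _
    rw [h, pow_succ]
    simp only [pdy, mul_neg, neg_mul, mul_one]

theorem isWeakDeriv_of_contDiff (hu : ContDiff ℝ ∞ u) (U : Set (ℝ × ℝ)) (i j : ℕ) :
    IsWeakDeriv U i j u (pdy^[j] (pdx^[i] u)) := by
  have hx := contDiff_iterate_pdx hu i
  have hxy := contDiff_iterate_pdy hx j
  refine ⟨hu.continuous.locallyIntegrable.locallyIntegrableOn _,
    hxy.continuous.locallyIntegrable.locallyIntegrableOn _, fun φ h1 h2 h3 => ?_⟩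
  have ht : IsTest U φ := ⟨h1, h2, h3⟩
  rw [((ht.iterate_pdy j).iterate_pdx i).setIntegral_mul, ht.setIntegral_mul,
    integral_mul_iterate_pdx i (ht.iterate_pdy j) hu, integral_mul_iterate_pdy j ht hx, pow_add,
    mul_assoc]

theorem measurePreserving_swap : MeasurePreserving (Prod.swap : ℝ × ℝ → ℝ × ℝ) volume volume :=
  Measure.measurePreserving_swap

theorem measurableEmbedding_swap : MeasurableEmbedding (Prod.swap : ℝ × ℝ → ℝ × ℝ) :=
  (MeasurableEquiv.prodComm : ℝ × ℝ ≃ᵐ ℝ × ℝ).measurableEmbedding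

theorem locallyIntegrableOn_comp_swap (h : LocallyIntegrableOn u U) :
    LocallyIntegrableOn (u ∘ Prod.swap) (Prod.swap ⁻¹' U) := by
  intro x hx
  obtain ⟨s, hs, hi⟩ := h x.swap hx
  refine ⟨Prod.swap ⁻¹' s, ?_, ?_⟩
  · have : Filter.Tendsto Prod.swap (nhdsWithin x (Prod.swap ⁻¹' U)) (nhdsWithin x.swap U) :=
      (continuous_swap.continuousWithinAt).tendsto_nhdsWithin fun _ h => h
    exact this hs
  · exact (measurePreserving_swap.integrableOn_comp_preimage measurableEmbedding_swap).2 hi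

theorem IsTest.comp_swap {φ : ℝ × ℝ → ℝ} (h : IsTest (Prod.swap ⁻¹' U) φ) :
    IsTest U (φ ∘ Prod.swap) := by
  refine ⟨h.1.comp (contDiff_snd.prodMk contDiff_fst),
    h.2.comp_homeomorph (Homeomorph.prodComm ℝ ℝ), ?_⟩
  have : tsupport (φ ∘ Prod.swap) ⊆ Prod.swap ⁻¹' tsupport φ :=
    tsupport_comp_subset_preimage φ continuous_swap
  exact this.trans fun p hp => h.3 hp

theorem pdy_comp_swap {φ : ℝ × ℝ → ℝ} (h : ContDiff ℝ ∞ φ) :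
    pdy (φ ∘ Prod.swap) = pdx φ ∘ Prod.swap := by
  funext p
  have e : HasFDerivAt (Prod.swap : ℝ × ℝ → ℝ × ℝ)
      ((ContinuousLinearMap.snd ℝ ℝ ℝ).prod (ContinuousLinearMap.fst ℝ ℝ ℝ)) p :=
    (hasFDerivAt_snd).prodMk hasFDerivAt_fst
  have := ((h.differentiable (by simp) p.swap).hasFDerivAt.comp p e).fderiv
  simp only [pdy, pdx, this, Function.comp_apply, ContinuousLinearMap.comp_apply]
  simp

/-- Exchanging the variables turns a `y`-derivative into an `x`-derivative. -/
theorem IsWeakDeriv.swap (h : IsWeakDeriv U 0 1 u g) :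
    IsWeakDeriv (Prod.swap ⁻¹' U) 1 0 (u ∘ Prod.swap) (g ∘ Prod.swap) := by
  refine ⟨locallyIntegrableOn_comp_swap h.1, locallyIntegrableOn_comp_swap h.2.1,
    fun φ h1 h2 h3 => ?_⟩
  have ht : IsTest U (φ ∘ Prod.swap) := IsTest.comp_swap ⟨h1, h2, h3⟩
  have e := h.2.2 _ ht.1 ht.2 ht.3
  have key : ∀ f ψ : ℝ × ℝ → ℝ, ∫ p in Prod.swap ⁻¹' U, (f ∘ Prod.swap) p * ψ p
      = ∫ p in U, f p * (ψ ∘ Prod.swap) p := by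
    intro f ψ
    simpa using measurePreserving_swap.setIntegral_preimage_emb measurableEmbedding_swap
      (fun q => f q * ψ q.swap) U
  simp only [Function.iterate_one, Function.iterate_zero, id, pdy_comp_swap h1] at e ⊢
  rw [key, key, e]

end ReducedMorley

namespace ReducedMorley

open Set Filter

/-- The integral of `g` in the first variable from `a`. -/
noncomputable def primX (a : ℝ) (g : ℝ × ℝ → ℝ) : ℝ × ℝ → ℝ := fun p => ∫ ξ in a..p.1, g (ξ, p.2)

/-- The integral of `g` in the second variable from `c`. -/
noncomputable def primY (c : ℝ) (g : ℝ × ℝ → ℝ) : ℝ × ℝ → ℝ := fun p => ∫ η in c..p.2, g (p.1, η)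

/-- The open box `(a, b) × (c, d)`. -/
def box (a b c d : ℝ) : Set (ℝ × ℝ) := Ioo a b ×ˢ Ioo c d

theorem isOpen_box (a b c d : ℝ) : IsOpen (box a b c d) := isOpen_Ioo.prod isOpen_Ioo

theorem restrict_box (a b c d : ℝ) : (volume.restrict (box a b c d) : Measure (ℝ × ℝ))
    = (volume.restrict (Ioo a b)).prod (volume.restrict (Ioo c d)) := by
  rw [Measure.prod_restrict, ← Measure.volume_eq_prod]; rfl

instance isFiniteMeasure_box (a b c d : ℝ) :
    IsFiniteMeasure (volume.restrict (box a b c d) : Measure (ℝ × ℝ)) := by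
  rw [restrict_box]; infer_instance

variable {a b c d : ℝ} {u g : ℝ × ℝ → ℝ}

theorem ae_box_mem : ∀ᵐ p ∂(volume.restrict (box a b c d)), p ∈ box a b c d :=
  ae_restrict_mem (isOpen_box a b c d).measurableSet

theorem ae_box_of_ae_snd {P : ℝ → Prop} (h : ∀ᵐ y ∂(volume.restrict (Ioo c d)), P y) :
    ∀ᵐ p ∂(volume.restrict (box a b c d)), P p.2 := by
  rw [restrict_box]
  exact Measure.quasiMeasurePreserving_snd.ae h

theorem ae_box_of_ae_fst {P : ℝ → Prop} (h : ∀ᵐ y ∂(volume.restrict (Ioo a b)), P y) :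
    ∀ᵐ p ∂(volume.restrict (box a b c d)), P p.1 := by
  rw [restrict_box]
  exact Measure.quasiMeasurePreserving_fst.ae h

theorem ae_slice_snd {P : ℝ × ℝ → Prop} (h : ∀ᵐ p ∂(volume.restrict (box a b c d)), P p) :
    ∀ᵐ y ∂(volume.restrict (Ioo c d)), ∀ᵐ x ∂(volume.restrict (Ioo a b)), P (x, y) := by
  rw [restrict_box] at h
  have := Measure.measurePreserving_swap (μ := volume.restrict (Ioo c d))
    (ν := volume.restrict (Ioo a b)) |>.quasiMeasurePreserving.ae h
  exact Measure.ae_ae_of_ae_prod this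

theorem ae_slice_fst {P : ℝ × ℝ → Prop} (h : ∀ᵐ p ∂(volume.restrict (box a b c d)), P p) :
    ∀ᵐ x ∂(volume.restrict (Ioo a b)), ∀ᵐ y ∂(volume.restrict (Ioo c d)), P (x, y) := by
  rw [restrict_box] at h
  exact Measure.ae_ae_of_ae_prod h

theorem ae_integrable_slice_snd (h : IntegrableOn g (box a b c d)) :
    ∀ᵐ y ∂(volume.restrict (Ioo c d)), IntegrableOn (fun x => g (x, y)) (Ioo a b) := by
  rw [IntegrableOn, restrict_box] at h
  exact h.prod_left_ae

theorem intervalIntegrable_of_integrableOn_Ioo {f : ℝ → ℝ} (hab : a ≤ b)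
    (h : IntegrableOn f (Ioo a b)) : IntervalIntegrable f volume a b := by
  rw [intervalIntegrable_iff_integrableOn_Ioo_of_le hab]; exact h

theorem intervalIntegral_eq_Ioo {f : ℝ → ℝ} (hab : a ≤ b) :
    ∫ x in a..b, f x = ∫ x in Ioo a b, f x := by
  rw [intervalIntegral.integral_of_le hab, integral_Ioc_eq_integral_Ioo]

theorem primX_eq_of_mem {p : ℝ × ℝ} (hp : p ∈ box a b c d) :
    primX a g p = ∫ ξ in Ioo a b, (if ξ ≤ p.1 then g (ξ, p.2) else 0) := by
  have h1 := hp.1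
  rw [primX, intervalIntegral.integral_of_le h1.1.le]
  have : (fun ξ => if ξ ≤ p.1 then g (ξ, p.2) else 0)
      = (Iic p.1).indicator (fun ξ => g (ξ, p.2)) := by
    funext ξ; simp [indicator_apply]
  rw [this, integral_indicator measurableSet_Iic, Measure.restrict_restrict measurableSet_Iic]
  congr 2
  ext ξ
  simp only [mem_Ioc, mem_inter_iff, mem_Iic, mem_Ioo]
  constructor
  · rintro ⟨h, h'⟩; exact ⟨h', h, h'.trans_lt h1.2⟩
  · rintro ⟨h, h', _⟩; exact ⟨h', h⟩

theorem aestronglyMeasurable_primX (hg : AEStronglyMeasurable g (volume.restrict (box a b c d))) :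
    AEStronglyMeasurable (primX a g) (volume.restrict (box a b c d)) := by
  have h1 : AEStronglyMeasurable
      (fun p => ∫ ξ in Ioo a b, (if ξ ≤ p.1 then g (ξ, p.2) else 0))
      (volume.restrict (box a b c d)) := by
    have hq : Measure.QuasiMeasurePreserving (fun q : (ℝ × ℝ) × ℝ => (q.2, q.1.2))
        ((volume.restrict (box a b c d)).prod (volume.restrict (Ioo a b)))
        (volume.restrict (box a b c d)) := by
      rw [restrict_box]
      have h2 : Measure.QuasiMeasurePreserving (Prod.map Prod.snd id)
          (((volume.restrict (Ioo a b)).prod (volume.restrict (Ioo c d))).prod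
            (volume.restrict (Ioo a b)))
          ((volume.restrict (Ioo c d)).prod (volume.restrict (Ioo a b))) := by
        refine ⟨measurable_snd.prodMap measurable_id, ?_⟩
        rw [← Measure.map_prod_map _ _ measurable_snd measurable_id, Measure.map_id]
        exact Measure.quasiMeasurePreserving_snd.absolutelyContinuous.prod
          Measure.AbsolutelyContinuous.rfl
      exact (Measure.measurePreserving_swap (μ := volume.restrict (Ioo c d))
        (ν := volume.restrict (Ioo a b))).quasiMeasurePreserving.comp h2
    have h3 := hg.comp_quasiMeasurePreserving hq
    have h4 : MeasurableSet {q : (ℝ × ℝ) × ℝ | q.2 ≤ q.1.1} :=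
      measurableSet_le measurable_snd (measurable_fst.comp measurable_fst)
    have h5 := (h3.indicator h4).integral_prod_right'
    refine h5.congr (Eventually.of_forall fun p => ?_)
    refine integral_congr_ae (Eventually.of_forall fun ξ => ?_)
    simp [indicator_apply]
  refine h1.congr ?_
  filter_upwards [ae_box_mem] with p hp
  rw [primX_eq_of_mem hp]

/-- The integral of `|g|` over a horizontal section. -/
noncomputable def sliceAbs (a b : ℝ) (g : ℝ × ℝ → ℝ) : ℝ × ℝ → ℝ :=
  fun p => ∫ ξ in Ioo a b, |g (ξ, p.2)|

theorem abs_primX_le (hg : IntegrableOn g (box a b c d)) :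
    ∀ᵐ p ∂(volume.restrict (box a b c d)), |primX a g p| ≤ sliceAbs a b g p := by
  filter_upwards [ae_box_mem, ae_box_of_ae_snd (ae_integrable_slice_snd hg)] with p hp hi
  rw [primX, intervalIntegral.integral_of_le hp.1.1.le]
  refine (abs_integral_le_integral_abs).trans ?_
  refine setIntegral_mono_set hi.abs (Eventually.of_forall fun _ => abs_nonneg _) ?_
  exact LE.le.eventuallyLE fun ξ hξ => ⟨hξ.1, hξ.2.trans_lt hp.1.2⟩

theorem integrable_sliceAbs (hg : IntegrableOn g (box a b c d)) :
    IntegrableOn (sliceAbs a b g) (box a b c d) := by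
  rw [IntegrableOn, restrict_box] at *
  exact hg.abs.integral_prod_right.comp_snd _

theorem integrableOn_primX (hg : IntegrableOn g (box a b c d)) :
    IntegrableOn (primX a g) (box a b c d) := by
  refine Integrable.mono' (integrable_sliceAbs hg) (aestronglyMeasurable_primX hg.1) ?_
  exact abs_primX_le hg

theorem integrableOn_box_mul (hg : IntegrableOn g (box a b c d)) {φ : ℝ × ℝ → ℝ}
    (hφ : Continuous φ) : IntegrableOn (fun p => g p * φ p) (box a b c d) := by
  have hK : IsCompact (Icc a b ×ˢ Icc c d) := isCompact_Icc.prod isCompact_Icc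
  obtain ⟨C, hC⟩ := hK.exists_bound_of_continuousOn hφ.continuousOn
  refine Integrable.mul_bdd hg hφ.aestronglyMeasurable (c := C) ?_
  filter_upwards [ae_box_mem] with p hp
  exact hC p ⟨Ioo_subset_Icc_self hp.1, Ioo_subset_Icc_self hp.2⟩

theorem integral_box_swap {f : ℝ × ℝ → ℝ} (hf : IntegrableOn f (box a b c d)) :
    ∫ p in box a b c d, f p = ∫ y in Ioo c d, ∫ x in Ioo a b, f (x, y) := by
  rw [IntegrableOn, restrict_box] at *
  exact integral_prod_symm f hf

theorem integral_primitive_mul_deriv (hab : a ≤ b) {f φ : ℝ → ℝ} (hf : IntegrableOn f (Ioo a b))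
    (hφ : ContDiff ℝ 1 φ) :
    ∫ x in Ioo a b, (∫ ξ in a..x, f ξ) * deriv φ x
      = (∫ ξ in Ioo a b, f ξ) * φ b - ∫ x in Ioo a b, f x * φ x := by
  have hi := intervalIntegrable_of_integrableOn_Ioo hab hf
  have h1 := hi.absolutelyContinuousOnInterval_intervalIntegral (c := a) (by simp)
  have h2 : AbsolutelyContinuousOnInterval φ a b := hφ.contDiffOn.absolutelyContinuousOnInterval
  have h3 := h1.integral_mul_deriv_eq_deriv_mul h2
  rw [← intervalIntegral_eq_Ioo hab, ← intervalIntegral_eq_Ioo hab, ← intervalIntegral_eq_Ioo hab,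
    h3]
  simp only [intervalIntegral.integral_same, zero_mul, sub_zero]
  congr 1
  refine intervalIntegral.integral_congr_ae ?_
  filter_upwards [hi.ae_hasDerivAt_integral] with x hx hx'
  rw [(hx (uIoc_subset_uIcc hx') a (by simp)).deriv]

theorem deriv_slice_fst {φ : ℝ × ℝ → ℝ} (hφ : ContDiff ℝ ∞ φ) (x y : ℝ) :
    HasDerivAt (fun x => φ (x, y)) (pdx φ (x, y)) x := by
  have h := (hφ.differentiable (by simp) (x, y)).hasFDerivAt
  have h2 : HasDerivAt (fun x : ℝ => (x, y)) ((1 : ℝ), (0 : ℝ)) x :=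
    (hasDerivAt_id x).prodMk (hasDerivAt_const x y)
  exact h.comp_hasDerivAt x h2

theorem contDiff_slice_fst {φ : ℝ × ℝ → ℝ} (hφ : ContDiff ℝ ∞ φ) (y : ℝ) :
    ContDiff ℝ ∞ (fun x => φ (x, y)) :=
  hφ.comp (contDiff_id.prodMk contDiff_const)

theorem integral_primX_mul_pdx (hab : a ≤ b) (hg : IntegrableOn g (box a b c d))
    {φ : ℝ × ℝ → ℝ} (hφ : ContDiff ℝ ∞ φ) :
    ∫ p in box a b c d, primX a g p * pdx φ p
      = (∫ y in Ioo c d, (∫ ξ in Ioo a b, g (ξ, y)) * φ (b, y))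
        - ∫ p in box a b c d, g p * φ p := by
  have h1 := integrableOn_box_mul (integrableOn_primX hg) (contDiff_pdx hφ).continuous
  have h2 := integrableOn_box_mul hg hφ.continuous
  have hJ : IntegrableOn (fun y => (∫ ξ in Ioo a b, g (ξ, y)) * φ (b, y)) (Ioo c d) := by
    have h0 : IntegrableOn (fun y => ∫ ξ in Ioo a b, g (ξ, y)) (Ioo c d) := by
      rw [IntegrableOn, restrict_box] at hg
      exact hg.integral_prod_right
    have hc : Continuous fun y => φ (b, y) := hφ.continuous.comp (by fun_prop)
    obtain ⟨C, hC⟩ := (isCompact_Icc (a := c) (b := d)).exists_bound_of_continuousOn hc.continuousOn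
    refine Integrable.mul_bdd h0 hc.aestronglyMeasurable (c := C) ?_
    filter_upwards [ae_restrict_mem measurableSet_Ioo] with y hy
    exact hC y (Ioo_subset_Icc_self hy)
  have h2' : Integrable (fun y => ∫ x in Ioo a b, g (x, y) * φ (x, y))
      (volume.restrict (Ioo c d)) := by
    rw [IntegrableOn, restrict_box] at h2
    exact h2.integral_prod_right
  rw [integral_box_swap h1, integral_box_swap h2, ← integral_sub hJ h2']
  refine integral_congr_ae ?_
  filter_upwards [ae_integrable_slice_snd hg] with y hy
  have := integral_primitive_mul_deriv hab hy ((contDiff_slice_fst hφ y).of_le (by simp))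
  simp only [(deriv_slice_fst hφ _ y).deriv] at this
  exact this

end ReducedMorley

namespace ReducedMorley

open Set Filter

variable {a b c d : ℝ} {u g : ℝ × ℝ → ℝ}

theorem exists_Ioo_of_isCompact_subset_Ioo (hab : a < b) {K : Set ℝ} (hK : IsCompact K)
    (h : K ⊆ Ioo a b) : ∃ a' b', a < a' ∧ a' < b' ∧ b' < b ∧ K ⊆ Ioo a' b' := by
  rcases K.eq_empty_or_nonempty with rfl | hne
  · exact ⟨(2 * a + b) / 3, (a + 2 * b) / 3, by linarith, by linarith, by linarith,
      empty_subset _⟩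
  · obtain ⟨m, hm, hm'⟩ := hK.exists_isLeast hne
    obtain ⟨M, hM, hM'⟩ := hK.exists_isGreatest hne
    have h1 := h hm
    have h2 := h hM
    have h3 : m ≤ M := hm' hM
    refine ⟨(a + m) / 2, (M + b) / 2, by linarith [h1.1], by linarith [h1.1, h2.2],
      by linarith [h2.2], fun x hx => ⟨?_, ?_⟩⟩
    · linarith [hm' hx, h1.1]
    · linarith [hM' hx, h2.2]

/-- Convolution in the first variable only is smooth. -/
theorem contDiff_integral_mul_sub {h : ℝ × ℝ → ℝ} (hh : ContDiff ℝ ∞ h)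
    (h0 : ∀ x y, x ∉ Icc a b → h (x, y) = 0) {f : ℝ → ℝ} (hf : LocallyIntegrable f) :
    ContDiff ℝ ∞ (fun p : ℝ × ℝ => ∫ t, h (t, p.2) * f (p.1 - t)) := by
  have h1 := contDiffOn_convolution_left_with_param (𝕜 := ℝ) (n := ⊤)
    (ContinuousLinearMap.mul ℝ ℝ) (μ := volume) (s := univ) (k := Icc a b)
    (g := fun (y x : ℝ) => h (x, y)) (f := f) isOpen_univ isCompact_Icc
    (fun y x _ hx => h0 x y hx) hf
    ((hh.comp (contDiff_snd.prodMk contDiff_fst)).contDiffOn)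
  rw [univ_prod_univ, contDiffOn_univ] at h1
  exact h1.comp (contDiff_snd.prodMk contDiff_fst)

theorem contDiff_integral_fst {h : ℝ × ℝ → ℝ} (hh : ContDiff ℝ ∞ h)
    (h0 : ∀ x y, x ∉ Icc a b → h (x, y) = 0) : ContDiff ℝ ∞ (fun y : ℝ => ∫ t, h (t, y)) := by
  have h1 := contDiff_integral_mul_sub hh h0 (f := fun _ => 1) (locallyIntegrable_const 1)
  simp only [mul_one] at h1
  exact h1.comp ((contDiff_const (c := (0 : ℝ))).prodMk contDiff_id)

theorem contDiff_primX {h : ℝ × ℝ → ℝ} (hh : ContDiff ℝ ∞ h)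
    (h0 : ∀ x y, x ∉ Ioo a b → h (x, y) = 0) : ContDiff ℝ ∞ (primX a h) := by
  have hf : LocallyIntegrable ((Ici (0 : ℝ)).indicator fun _ => (1 : ℝ)) :=
    (locallyIntegrable_const 1).indicator measurableSet_Ici
  have h1 := contDiff_integral_mul_sub hh (a := a) (b := b)
    (fun x y hx => h0 x y fun hx' => hx (Ioo_subset_Icc_self hx')) hf
  convert h1 using 1
  funext p
  have hc : Continuous fun t => h (t, p.2) := hh.continuous.comp (by fun_prop)
  have hi : Integrable fun t => h (t, p.2) := by
    refine hc.integrable_of_hasCompactSupport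
      (HasCompactSupport.intro (isCompact_Icc (a := a) (b := b)) ?_)
    exact fun x hx => h0 x _ fun hx' => hx (Ioo_subset_Icc_self hx')
  have e1 : ∫ t, h (t, p.2) * (Ici (0 : ℝ)).indicator (fun _ => (1 : ℝ)) (p.1 - t)
      = ∫ t in Iic p.1, h (t, p.2) := by
    rw [← integral_indicator measurableSet_Iic]
    refine integral_congr_ae (Eventually.of_forall fun t => ?_)
    simp [indicator_apply]
  have e2 : ∫ t in Iic a, h (t, p.2) = 0 :=
    setIntegral_eq_zero_of_forall_eq_zero fun t ht => h0 t _ fun h' => absurd h'.1 (not_lt.2 ht)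
  rw [e1, primX, ← intervalIntegral.integral_Iic_sub_Iic hi.integrableOn hi.integrableOn, e2,
    sub_zero]

theorem pdx_primX {h : ℝ × ℝ → ℝ} (hh : ContDiff ℝ ∞ h)
    (h0 : ∀ x y, x ∉ Ioo a b → h (x, y) = 0) : pdx (primX a h) = h := by
  funext p
  have h1 := deriv_slice_fst (contDiff_primX hh h0) p.1 p.2
  have hc : Continuous fun t => h (t, p.2) := hh.continuous.comp (by fun_prop)
  have h2 : HasDerivAt (fun x => primX a h (x, p.2)) (h (p.1, p.2)) p.1 :=
    (hc.integral_hasStrictDerivAt a p.1).hasDerivAt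
  exact h1.unique h2

theorem exists_smooth_weight (hab : a < b) : ∃ θ : ℝ → ℝ, ∃ a' b' : ℝ, ContDiff ℝ ∞ θ ∧
    ∫ x, θ x = 1 ∧ a < a' ∧ a' < b' ∧ b' < b ∧ ∀ x, x ∉ Ioo a' b' → θ x = 0 := by
  let f : ContDiffBump ((a + b) / 2) :=
    ⟨(b - a) / 8, (b - a) / 4, by linarith, by linarith⟩
  refine ⟨f.normed volume, (a + b) / 2 - (b - a) / 4, (a + b) / 2 + (b - a) / 4,
    f.contDiff_normed, f.integral_normed, by linarith, by linarith, by linarith, fun x hx => ?_⟩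
  have h1 : x ∉ Function.support (f.normed volume) := by
    rw [f.support_normed_eq, Real.ball_eq_Ioo]; exact hx
  simpa using h1

/-- A test function on a box is, up to a multiple of a fixed weight, the `x`-derivative of a test
function. -/
theorem IsTest.exists_pdx_eq {φ : ℝ × ℝ → ℝ} (hφ : IsTest (box a b c d) φ) (hab : a < b)
    (hcd : c < d) {θ : ℝ → ℝ} {a' b' : ℝ} (hθ : ContDiff ℝ ∞ θ) (hθ1 : ∫ x, θ x = 1) (ha' : a < a')
    (hb' : b' < b) (hθ0 : ∀ x, x ∉ Ioo a' b' → θ x = 0) :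
    ∃ ψ, IsTest (box a b c d) ψ ∧
      ∀ x y, ReducedMorley.pdx ψ (x, y) = φ (x, y) - θ x * ∫ t in Ioo a b, φ (t, y) := by
  obtain ⟨a₁, b₁, h1, h2, h3, h4⟩ := exists_Ioo_of_isCompact_subset_Ioo hab
    (hφ.2.isCompact.image continuous_fst)
    (by rintro _ ⟨p, hp, rfl⟩; exact (hφ.3 hp).1)
  obtain ⟨c₁, d₁, k1, k2, k3, k4⟩ := exists_Ioo_of_isCompact_subset_Ioo hcd
    (hφ.2.isCompact.image continuous_snd)
    (by rintro _ ⟨p, hp, rfl⟩; exact (hφ.3 hp).2)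
  have hφx : ∀ x y, x ∉ Ioo a₁ b₁ → φ (x, y) = 0 := fun x y hx => by
    by_contra h0
    exact hx (h4 ⟨(x, y), subset_tsupport _ h0, rfl⟩)
  have hφy : ∀ x y, y ∉ Ioo c₁ d₁ → φ (x, y) = 0 := fun x y hx => by
    by_contra h0
    exact hx (k4 ⟨(x, y), subset_tsupport _ h0, rfl⟩)
  have hI : ContDiff ℝ ∞ (fun y : ℝ => ∫ t, φ (t, y)) :=
    contDiff_integral_fst (a := a₁) (b := b₁) hφ.1
      fun x y hx => hφx x y fun hx' => hx (Ioo_subset_Icc_self hx')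
  have hI' : ∀ y, ∫ t in Ioo a b, φ (t, y) = ∫ t, φ (t, y) := fun y =>
    setIntegral_eq_integral_of_forall_compl_eq_zero fun x hx =>
      hφx x y fun hx' => hx ⟨h1.trans hx'.1, hx'.2.trans h3⟩
  let a₂ := min a₁ a'
  let b₂ := max b₁ b'
  have ha₂ : a < a₂ := lt_min h1 ha'
  have hb₂ : b₂ < b := max_lt h3 hb'
  let h : ℝ × ℝ → ℝ := fun p => φ p - θ p.1 * ∫ t, φ (t, p.2)
  have hh : ContDiff ℝ ∞ h :=
    hφ.1.sub ((hθ.comp contDiff_fst).mul (hI.comp contDiff_snd))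
  have hx0 : ∀ x y, x ∉ Ioo a₂ b₂ → h (x, y) = 0 := by
    intro x y hx
    have e1 : φ (x, y) = 0 := hφx x y fun h' =>
      hx ⟨(min_le_left _ _).trans_lt h'.1, h'.2.trans_le (le_max_left _ _)⟩
    have e2 : θ x = 0 := hθ0 x fun h' =>
      hx ⟨(min_le_right _ _).trans_lt h'.1, h'.2.trans_le (le_max_right _ _)⟩
    simp [h, e1, e2]
  have hy0 : ∀ x y, y ∉ Ioo c₁ d₁ → h (x, y) = 0 := by
    intro x y hy
    simp [h, hφy _ y hy]
  have hφi : ∀ y, Integrable fun t => φ (t, y) := fun y => by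
    have hc : Continuous fun t => φ (t, y) := hφ.continuous.comp (by fun_prop)
    refine hc.integrable_of_hasCompactSupport
      (HasCompactSupport.intro (isCompact_Icc (a := a₁) (b := b₁)) ?_)
    exact fun x hx => hφx x _ fun hx' => hx (Ioo_subset_Icc_self hx')
  have hθi : Integrable θ :=
    hθ.continuous.integrable_of_hasCompactSupport
      (HasCompactSupport.intro (isCompact_Icc (a := a') (b := b'))
        fun x hx => hθ0 x fun hx' => hx (Ioo_subset_Icc_self hx'))
  have hint : ∀ y, ∫ t, h (t, y) = 0 := by
    intro y
    simp only [h]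
    rw [integral_sub (hφi y) (hθi.mul_const _), integral_mul_const, hθ1, one_mul, sub_self]
  have hψ0 : ∀ p, p ∉ Icc a₂ b₂ ×ˢ Icc c₁ d₁ → primX a₂ h p = 0 := by
    rintro ⟨x, y⟩ hp
    by_cases hy : y ∈ Icc c₁ d₁
    · have hx : x ∉ Icc a₂ b₂ := fun hx => hp ⟨hx, hy⟩
      rw [mem_Icc, not_and_or, not_le, not_le] at hx
      rcases hx with hx | hx
      · rw [primX, intervalIntegral.integral_symm, intervalIntegral.integral_of_le hx.le]
        rw [setIntegral_eq_zero_of_forall_eq_zero, neg_zero]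
        exact fun t ht => hx0 t y fun h' => absurd h'.1 (not_lt.2 ht.2)
      · have hlt : a₂ < x := ((min_le_left _ _).trans_lt h2).trans_le (le_max_left _ _) |>.trans hx
        rw [primX, intervalIntegral.integral_of_le hlt.le, ← hint y]
        refine setIntegral_eq_integral_of_forall_compl_eq_zero fun t ht => hx0 t y fun h' => ?_
        exact ht ⟨h'.1, (h'.2.trans hx).le⟩
    · have : ∀ t, h (t, y) = 0 := fun t => hy0 t y fun h' => hy (Ioo_subset_Icc_self h')
      simp [primX, this]
  have hcl : tsupport (primX a₂ h) ⊆ Icc a₂ b₂ ×ˢ Icc c₁ d₁ :=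
    closure_minimal (fun p hp => by by_contra h'; exact hp (hψ0 p h'))
      (isClosed_Icc.prod isClosed_Icc)
  refine ⟨primX a₂ h, ⟨contDiff_primX hh hx0,
    HasCompactSupport.intro (isCompact_Icc.prod isCompact_Icc) hψ0, hcl.trans ?_⟩, fun x y => ?_⟩
  · exact prod_mono (Icc_subset_Ioo ha₂ hb₂) (Icc_subset_Ioo k1 k3)
  · rw [pdx_primX hh hx0, hI']

/-- A function on a box with an integrable weak `x`-derivative `g` is, almost everywhere, the sum of
a function of `y` and of the primitive of `g` in `x`. -/
theorem IsWeakDeriv.exists_eq_add_primX (hab : a < b) (hcd : c < d)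
    (h : IsWeakDeriv (box a b c d) 1 0 u g) (hu : IntegrableOn u (box a b c d))
    (hg : IntegrableOn g (box a b c d)) :
    ∃ B : ℝ → ℝ, IntegrableOn B (Ioo c d) ∧
      ∀ᵐ p ∂(volume.restrict (box a b c d)), u p = B p.2 + primX a g p := by
  obtain ⟨θ, a', b', hθ, hθ1, ha', -, hb', hθ0⟩ := exists_smooth_weight hab
  set z : ℝ × ℝ → ℝ := fun p => u p - primX a g p with hz
  have hzi : IntegrableOn z (box a b c d) := hu.sub (integrableOn_primX hg)
  have hzθ : IntegrableOn (fun p => z p * θ p.1) (box a b c d) :=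
    integrableOn_box_mul hzi (hθ.continuous.comp continuous_fst)
  set B : ℝ → ℝ := fun y => ∫ x in Ioo a b, z (x, y) * θ x with hB
  have hBi : IntegrableOn B (Ioo c d) := by
    rw [IntegrableOn, restrict_box] at hzθ
    exact hzθ.integral_prod_right
  have hBi2 : IntegrableOn (fun p : ℝ × ℝ => B p.2) (box a b c d) := by
    rw [IntegrableOn, restrict_box]
    exact Integrable.comp_snd hBi _
  refine ⟨B, hBi, ?_⟩
  have key : ∀ᵐ p ∂volume, p ∈ box a b c d → z p - B p.2 = 0 := by
    refine (isOpen_box a b c d).ae_eq_zero_of_integral_contDiff_smul_eq_zero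
      (hzi.sub hBi2).locallyIntegrableOn ?_
    intro φ p1 p2 p3
    have hφ : IsTest (box a b c d) φ := ⟨p1, p2, p3⟩
    obtain ⟨ψ, hψ, hψ'⟩ := hφ.exists_pdx_eq hab hcd hθ hθ1 ha' hb' hθ0
    have e1 := h.2.2 ψ hψ.1 hψ.2 hψ.3
    have e2 := integral_primX_mul_pdx hab.le hg hψ.1
    have e3 : ∀ y, ψ (b, y) = 0 := fun y => hψ.eq_zero fun h' => lt_irrefl _ h'.1.2
    simp only [Function.iterate_one, Function.iterate_zero, id, e3, mul_zero,
      integral_zero] at e1 e2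
    have e4 : ∫ p in box a b c d, z p * pdx ψ p = 0 := by
      simp only [hz, sub_mul]
      rw [integral_sub (integrableOn_box_mul hu hψ.pdx.continuous)
        (integrableOn_box_mul (integrableOn_primX hg) hψ.pdx.continuous), e1, e2]
      norm_num
    have i1 : IntegrableOn (fun p => z p * φ p) (box a b c d) :=
      integrableOn_box_mul hzi hφ.continuous
    have i2 : IntegrableOn (fun p => B p.2 * φ p) (box a b c d) :=
      integrableOn_box_mul hBi2 hφ.continuous
    have i3 : IntegrableOn (fun p : ℝ × ℝ => z p * θ p.1 * ∫ t in Ioo a b, φ (t, p.2))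
        (box a b c d) := by
      refine (i1.sub (integrableOn_box_mul hzi hψ.pdx.continuous)).congr
        (Eventually.of_forall fun p => ?_)
      simp only [Pi.sub_apply]
      rw [show p = (p.1, p.2) from rfl, hψ']
      ring
    have e5 : ∫ p in box a b c d, z p * θ p.1 * ∫ t in Ioo a b, φ (t, p.2)
        = ∫ p in box a b c d, B p.2 * φ p := by
      rw [integral_box_swap i3, integral_box_swap i2]
      congr 1
      funext y
      simp only
      rw [integral_mul_const, integral_const_mul]
    have e6 : ∫ p in box a b c d, z p * φ p = ∫ p in box a b c d, B p.2 * φ p := by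
      rw [← e5, ← sub_eq_zero, ← integral_sub i1 i3, ← e4]
      refine integral_congr_ae (Eventually.of_forall fun p => ?_)
      simp only
      rw [show p = (p.1, p.2) from rfl, hψ']
      ring
    have e7 : ∫ p in box a b c d, (z p - B p.2) * φ p = 0 := by
      simp only [sub_mul]
      rw [integral_sub i1 i2, e6, sub_self]
    rw [hφ.setIntegral_mul] at e7
    simpa [mul_comm] using e7
  rw [ae_restrict_iff' (isOpen_box a b c d).measurableSet]
  filter_upwards [key] with p hp hp'
  have := hp hp'
  simp only [hz] at this
  linarith

end ReducedMorley

namespace ReducedMorley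

open Set Filter
open scoped ENNReal

variable {a b c d : ℝ} {u g : ℝ × ℝ → ℝ}

theorem preimage_swap_box (a b c d : ℝ) :
    (Prod.swap ⁻¹' box a b c d : Set (ℝ × ℝ)) = box c d a b := by
  ext p
  simp only [box, mem_preimage, mem_prod, Prod.fst_swap, Prod.snd_swap]
  exact and_comm

theorem measurePreserving_swap_box (a b c d : ℝ) :
    MeasurePreserving (Prod.swap : ℝ × ℝ → ℝ × ℝ) (volume.restrict (box a b c d))
      (volume.restrict (box c d a b)) := by
  have := measurePreserving_swap.restrict_preimage (isOpen_box c d a b).measurableSet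
  rwa [preimage_swap_box] at this

theorem integrableOn_comp_swap (h : IntegrableOn g (box a b c d)) :
    IntegrableOn (g ∘ Prod.swap) (box c d a b) :=
  ((measurePreserving_swap_box c d a b).integrable_comp_emb measurableEmbedding_swap).2 h

/-- A function on a box with an integrable weak `y`-derivative `g` is, almost everywhere, the sum of
a function of `x` and of the primitive of `g` in `y`. -/
theorem IsWeakDeriv.exists_eq_add_primY (hab : a < b) (hcd : c < d)
    (h : IsWeakDeriv (box a b c d) 0 1 u g) (hu : IntegrableOn u (box a b c d))
    (hg : IntegrableOn g (box a b c d)) :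
    ∃ A : ℝ → ℝ, IntegrableOn A (Ioo a b) ∧
      ∀ᵐ p ∂(volume.restrict (box a b c d)), u p = A p.1 + primY c g p := by
  have h' := h.swap
  rw [preimage_swap_box] at h'
  obtain ⟨A, hA, hA'⟩ := h'.exists_eq_add_primX hcd hab (integrableOn_comp_swap hu)
    (integrableOn_comp_swap hg)
  refine ⟨A, hA, ?_⟩
  filter_upwards [(measurePreserving_swap_box a b c d).quasiMeasurePreserving.ae hA'] with p hp
  exact hp

theorem integrableOn_primY (hg : IntegrableOn g (box a b c d)) :
    IntegrableOn (primY c g) (box a b c d) := by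
  have h := integrableOn_primX (integrableOn_comp_swap hg)
  exact integrableOn_comp_swap h

theorem lintegral_sq_le {α : Type*} [MeasurableSpace α] (μ : Measure α) {f : α → ℝ≥0∞}
    (hf : AEMeasurable f μ) : (∫⁻ x, f x ∂μ) ^ 2 ≤ μ univ * ∫⁻ x, f x ^ 2 ∂μ := by
  have h := ENNReal.lintegral_mul_le_Lp_mul_Lq μ Real.HolderConjugate.two_two hf
    (aemeasurable_const (b := (1 : ℝ≥0∞)))
  simp only [Pi.mul_apply, mul_one, ENNReal.one_rpow, lintegral_const, one_mul] at h
  calc (∫⁻ x, f x ∂μ) ^ 2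
      ≤ ((∫⁻ x, f x ^ (2 : ℝ) ∂μ) ^ (1 / 2 : ℝ) * μ univ ^ (1 / 2 : ℝ)) ^ 2 := by gcongr
    _ = μ univ * ∫⁻ x, f x ^ 2 ∂μ := by
        rw [mul_pow, ← ENNReal.rpow_natCast, ← ENNReal.rpow_natCast, ← ENNReal.rpow_mul,
          ← ENNReal.rpow_mul]
        norm_num [mul_comm]

theorem eLpNorm_two_eq {α : Type*} [MeasurableSpace α] (μ : Measure α) (f : α → ℝ) :
    eLpNorm f 2 μ = (∫⁻ x, ‖f x‖ₑ ^ 2 ∂μ) ^ (1 / 2 : ℝ) := by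
  rw [eLpNorm_eq_lintegral_rpow_enorm_toReal two_ne_zero ENNReal.ofNat_ne_top]
  simp

theorem memLp_integrableOn (hg : MemLp g 2 (volume.restrict (box a b c d))) :
    IntegrableOn g (box a b c d) :=
  hg.integrable one_le_two

theorem eLpNorm_sliceAbs_le (hg : MemLp g 2 (volume.restrict (box a b c d))) :
    eLpNorm (sliceAbs a b g) 2 (volume.restrict (box a b c d))
      ≤ ENNReal.ofReal (b - a) * eLpNorm g 2 (volume.restrict (box a b c d)) := by
  have hm : AEMeasurable (fun p => ‖g p‖ₑ ^ 2) ((volume.restrict (Ioo a b)).prod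
      (volume.restrict (Ioo c d))) := by
    have := hg.1.enorm
    rw [restrict_box] at this
    exact this.pow_const 2
  have key : ∫⁻ p, ‖sliceAbs a b g p‖ₑ ^ 2 ∂(volume.restrict (box a b c d))
      ≤ ENNReal.ofReal (b - a) ^ 2 * ∫⁻ p, ‖g p‖ₑ ^ 2 ∂(volume.restrict (box a b c d)) := by
    have hs : ∀ᵐ y ∂(volume.restrict (Ioo c d)),
        ‖∫ ξ in Ioo a b, |g (ξ, y)|‖ₑ ^ 2
          ≤ ENNReal.ofReal (b - a) * ∫⁻ ξ in Ioo a b, ‖g (ξ, y)‖ₑ ^ 2 := by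
      filter_upwards [ae_integrable_slice_snd (memLp_integrableOn hg)] with y hy
      calc ‖∫ ξ in Ioo a b, |g (ξ, y)|‖ₑ ^ 2
          ≤ (∫⁻ ξ in Ioo a b, ‖g (ξ, y)‖ₑ) ^ 2 := by
            gcongr
            refine (enorm_integral_le_lintegral_enorm _).trans (le_of_eq ?_)
            simp
        _ ≤ _ := by
            refine (lintegral_sq_le _ hy.1.enorm).trans (le_of_eq ?_)
            simp
    have hm2 : AEMeasurable (fun p => ‖sliceAbs a b g p‖ₑ ^ 2)
        ((volume.restrict (Ioo a b)).prod (volume.restrict (Ioo c d))) := by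
      have := (integrable_sliceAbs (memLp_integrableOn hg)).1.enorm
      rw [restrict_box] at this
      exact this.pow_const 2
    rw [restrict_box, lintegral_prod_symm _ hm, lintegral_prod_symm _ hm2]
    simp only [sliceAbs, lintegral_const, Measure.restrict_apply_univ, Real.volume_Ioo]
    calc ∫⁻ y in Ioo c d, ‖∫ ξ in Ioo a b, |g (ξ, y)|‖ₑ ^ 2 * ENNReal.ofReal (b - a)
        ≤ ∫⁻ y in Ioo c d, ENNReal.ofReal (b - a) ^ 2 * ∫⁻ ξ in Ioo a b, ‖g (ξ, y)‖ₑ ^ 2 := by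
          refine lintegral_mono_ae ?_
          filter_upwards [hs] with y hy
          calc _ ≤ (ENNReal.ofReal (b - a) * ∫⁻ ξ in Ioo a b, ‖g (ξ, y)‖ₑ ^ 2)
                * ENNReal.ofReal (b - a) := by gcongr
            _ = _ := by ring
      _ = _ := lintegral_const_mul' _ _ (by simp)
  rw [eLpNorm_two_eq, eLpNorm_two_eq]
  calc _ ≤ (ENNReal.ofReal (b - a) ^ 2
        * ∫⁻ p, ‖g p‖ₑ ^ 2 ∂(volume.restrict (box a b c d))) ^ (1 / 2 : ℝ) := by gcongr
    _ = _ := by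
      rw [ENNReal.mul_rpow_of_nonneg _ _ (by norm_num), ← ENNReal.rpow_natCast,
        ← ENNReal.rpow_mul]
      norm_num

theorem memLp_sliceAbs (hg : MemLp g 2 (volume.restrict (box a b c d))) :
    MemLp (sliceAbs a b g) 2 (volume.restrict (box a b c d)) :=
  ⟨(integrable_sliceAbs (memLp_integrableOn hg)).1,
    (eLpNorm_sliceAbs_le hg).trans_lt (ENNReal.mul_lt_top ENNReal.ofReal_lt_top hg.2)⟩

theorem memLp_primX (hg : MemLp g 2 (volume.restrict (box a b c d))) :
    MemLp (primX a g) 2 (volume.restrict (box a b c d)) :=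
  (memLp_sliceAbs hg).mono' (integrableOn_primX (memLp_integrableOn hg)).1
    (abs_primX_le (memLp_integrableOn hg))

theorem memLp_comp_swap (hg : MemLp g 2 (volume.restrict (box a b c d))) :
    MemLp (g ∘ Prod.swap) 2 (volume.restrict (box c d a b)) :=
  hg.comp_measurePreserving (measurePreserving_swap_box c d a b)

theorem memLp_primY (hg : MemLp g 2 (volume.restrict (box a b c d))) :
    MemLp (primY c g) 2 (volume.restrict (box a b c d)) :=
  memLp_comp_swap (memLp_primX (memLp_comp_swap hg))

section l2norm

variable {U : Set (ℝ × ℝ)} {f : ℝ × ℝ → ℝ}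

theorem l2norm_nonneg : 0 ≤ l2norm U f := ENNReal.toReal_nonneg

theorem l2norm_congr (h : f =ᵐ[volume.restrict U] g) : l2norm U f = l2norm U g := by
  rw [l2norm, l2norm, eLpNorm_congr_ae h]

theorem l2norm_mono (hg : MemLp g 2 (volume.restrict U))
    (h : ∀ᵐ p ∂(volume.restrict U), |f p| ≤ g p) : l2norm U f ≤ l2norm U g := by
  refine ENNReal.toReal_mono hg.2.ne (eLpNorm_mono_ae_real ?_)
  simpa using h

theorem l2norm_add_le (hf : MemLp f 2 (volume.restrict U)) (hg : MemLp g 2 (volume.restrict U)) :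
    l2norm U (fun p => f p + g p) ≤ l2norm U f + l2norm U g := by
  rw [l2norm, l2norm, l2norm, ← ENNReal.toReal_add hf.2.ne hg.2.ne]
  exact ENNReal.toReal_mono (ENNReal.add_ne_top.2 ⟨hf.2.ne, hg.2.ne⟩)
    (eLpNorm_add_le hf.1 hg.1 one_le_two)

theorem l2norm_const_mul (r : ℝ) : l2norm U (fun p => r * f p) = |r| * l2norm U f := by
  have := eLpNorm_const_smul r f 2 (volume.restrict U)
  rw [l2norm, l2norm]
  change (eLpNorm (r • f) 2 _).toReal = _
  rw [this, ENNReal.toReal_mul]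
  simp

theorem l2norm_abs : l2norm U (fun p => |f p|) = l2norm U f := by
  rw [l2norm, l2norm]
  congr 1
  exact eLpNorm_norm f

end l2norm

theorem l2norm_sliceAbs_le (hab : a ≤ b) (hg : MemLp g 2 (volume.restrict (box a b c d))) :
    l2norm (box a b c d) (sliceAbs a b g) ≤ (b - a) * l2norm (box a b c d) g := by
  have h := ENNReal.toReal_mono (ENNReal.mul_ne_top ENNReal.ofReal_ne_top hg.2.ne)
    (eLpNorm_sliceAbs_le hg)
  rwa [ENNReal.toReal_mul, ENNReal.toReal_ofReal (by linarith)] at h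

theorem l2norm_primX_le (hab : a ≤ b) (hg : MemLp g 2 (volume.restrict (box a b c d))) :
    l2norm (box a b c d) (primX a g) ≤ (b - a) * l2norm (box a b c d) g :=
  (l2norm_mono (memLp_sliceAbs hg) (abs_primX_le (memLp_integrableOn hg))).trans
    (l2norm_sliceAbs_le hab hg)

theorem l2norm_comp_swap (hg : MemLp g 2 (volume.restrict (box a b c d))) :
    l2norm (box c d a b) (g ∘ Prod.swap) = l2norm (box a b c d) g := by
  rw [l2norm, l2norm, eLpNorm_comp_measurePreserving hg.1 (measurePreserving_swap_box c d a b)]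

theorem l2norm_primY_le (hcd : c ≤ d) (hg : MemLp g 2 (volume.restrict (box a b c d))) :
    l2norm (box a b c d) (primY c g) ≤ (d - c) * l2norm (box a b c d) g := by
  have h := l2norm_primX_le hcd (memLp_comp_swap hg)
  rw [l2norm_comp_swap hg, ← l2norm_comp_swap (memLp_primX (memLp_comp_swap hg))] at h
  exact h

/-- The mean value over the box. -/
noncomputable def mean (a b c d : ℝ) (f : ℝ × ℝ → ℝ) : ℝ :=
  ((b - a) * (d - c))⁻¹ * ∫ p in box a b c d, f p

theorem measureReal_box (hab : a ≤ b) (hcd : c ≤ d) :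
    (volume.restrict (box a b c d) : Measure (ℝ × ℝ)).real univ = (b - a) * (d - c) := by
  rw [restrict_box]
  simp [Measure.real, ENNReal.toReal_mul, hab, hcd, ← univ_prod_univ,
    Measure.prod_prod]

theorem mean_sub {f : ℝ × ℝ → ℝ} (hf : IntegrableOn f (box a b c d))
    (hg : IntegrableOn g (box a b c d)) :
    mean a b c d (fun p => f p - g p) = mean a b c d f - mean a b c d g := by
  rw [mean, integral_sub hf hg, mul_sub]; rfl

theorem mean_const (hab : a < b) (hcd : c < d) (r : ℝ) : mean a b c d (fun _ => r) = r := by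
  have : 0 < (b - a) * (d - c) := mul_pos (by linarith) (by linarith)
  rw [mean, integral_const, measureReal_box hab.le hcd.le, smul_eq_mul]
  exact inv_mul_cancel_left₀ this.ne' r

theorem l2norm_const_mean_le (hab : a < b) (hcd : c < d)
    (hg : MemLp g 2 (volume.restrict (box a b c d))) :
    l2norm (box a b c d) (fun _ => mean a b c d g) ≤ l2norm (box a b c d) g := by
  have hpos : 0 < (b - a) * (d - c) := mul_pos (by linarith) (by linarith)
  set μ : Measure (ℝ × ℝ) := volume.restrict (box a b c d) with hμ
  have hμr : μ univ = ENNReal.ofReal ((b - a) * (d - c)) := by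
    rw [← measureReal_box hab.le hcd.le, Measure.real, ENNReal.ofReal_toReal (measure_ne_top _ _)]
  refine ENNReal.toReal_mono hg.2.ne ?_
  rw [eLpNorm_two_eq, eLpNorm_two_eq]
  refine ENNReal.rpow_le_rpow ?_ (by norm_num)
  rw [lintegral_const]
  have h1 : ‖mean a b c d g‖ₑ ≤ (μ univ)⁻¹ * ∫⁻ p, ‖g p‖ₑ ∂μ := by
    rw [mean, enorm_mul]
    gcongr
    · rw [hμr, ← ENNReal.ofReal_inv_of_pos hpos, Real.enorm_eq_ofReal (by positivity)]
    · exact enorm_integral_le_lintegral_enorm _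
  have hne0 : μ univ ≠ 0 := by rw [hμr]; simpa using hpos
  have hnet : μ univ ≠ ⊤ := measure_ne_top _ _
  calc ‖mean a b c d g‖ₑ ^ 2 * μ univ
      ≤ ((μ univ)⁻¹ * ∫⁻ p, ‖g p‖ₑ ∂μ) ^ 2 * μ univ := by gcongr
    _ = (μ univ)⁻¹ ^ 2 * (∫⁻ p, ‖g p‖ₑ ∂μ) ^ 2 * μ univ := by rw [mul_pow]
    _ ≤ (μ univ)⁻¹ ^ 2 * (μ univ * ∫⁻ p, ‖g p‖ₑ ^ 2 ∂μ) * μ univ := by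
        gcongr; exact lintegral_sq_le _ hg.1.enorm
    _ = ((μ univ)⁻¹ * μ univ) ^ 2 * ∫⁻ p, ‖g p‖ₑ ^ 2 ∂μ := by ring
    _ = _ := by rw [ENNReal.inv_mul_cancel hne0 hnet]; simp [hμ]

theorem l2norm_sub_mean_le (hab : a < b) (hcd : c < d)
    (hg : MemLp g 2 (volume.restrict (box a b c d))) (k : ℝ) :
    l2norm (box a b c d) (fun p => g p - mean a b c d g)
      ≤ 2 * l2norm (box a b c d) (fun p => g p - k) := by
  have hk : MemLp (fun p => g p - k) 2 (volume.restrict (box a b c d)) :=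
    hg.sub (memLp_const k)
  have e : mean a b c d (fun p => g p - k) = mean a b c d g - k := by
    rw [mean_sub (memLp_integrableOn hg) (memLp_integrableOn (memLp_const k)),
      mean_const hab hcd]
  have h1 := l2norm_add_le hk (memLp_const (-1 * mean a b c d fun p => g p - k))
  have h2 := l2norm_const_mean_le hab hcd hk
  rw [l2norm_const_mul (-1) (f := fun _ => mean a b c d fun p => g p - k)] at h1
  simp only [abs_neg, abs_one, one_mul] at h1
  have e2 : (fun p => g p - k + -1 * mean a b c d fun p => g p - k)
      = fun p => g p - mean a b c d g := by
    funext p; rw [e]; ring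
  rw [e2] at h1
  linarith

/-- `w ∈ H¹` on the box, with weak first derivatives `wx` and `wy`. -/
structure IsH1 (a b c d : ℝ) (w wx wy : ℝ × ℝ → ℝ) : Prop where
  memLp : MemLp w 2 (volume.restrict (box a b c d))
  memLp_x : MemLp wx 2 (volume.restrict (box a b c d))
  memLp_y : MemLp wy 2 (volume.restrict (box a b c d))
  deriv_x : IsWeakDeriv (box a b c d) 1 0 w wx
  deriv_y : IsWeakDeriv (box a b c d) 0 1 w wy

theorem abs_setIntegral_slice_le (f : ℝ × ℝ → ℝ) (y : ℝ) :
    |∫ ξ in Ioo a b, f (ξ, y)| ≤ ∫ ξ in Ioo a b, |f (ξ, y)| := abs_integral_le_integral_abs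

/-- The Poincaré inequality on a box. -/
theorem IsH1.l2norm_sub_mean_le {w wx wy : ℝ × ℝ → ℝ} (h : IsH1 a b c d w wx wy) (hab : a < b)
    (hcd : c < d) : l2norm (box a b c d) (fun p => w p - mean a b c d w)
      ≤ 4 * (b - a) * l2norm (box a b c d) wx + 2 * (d - c) * l2norm (box a b c d) wy := by
  have iw := memLp_integrableOn h.memLp
  have ix := memLp_integrableOn h.memLp_x
  have iy := memLp_integrableOn h.memLp_y
  obtain ⟨B, hB, hwB⟩ := h.deriv_x.exists_eq_add_primX hab hcd iw ix
  obtain ⟨A, hA, hwA⟩ := h.deriv_y.exists_eq_add_primY hab hcd iw iy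
  have hpos : 0 < b - a := by linarith
  set k := (b - a)⁻¹ * ∫ x in Ioo a b, A x with hk
  have mX := memLp_primX h.memLp_x
  have mY := memLp_primY h.memLp_y
  have sX := memLp_sliceAbs mX
  have sY := memLp_sliceAbs mY
  have hBk : ∀ᵐ y ∂(volume.restrict (Ioo c d)), |B y - k|
      ≤ (b - a)⁻¹ * ((∫ ξ in Ioo a b, |primX a wx (ξ, y)|)
        + ∫ ξ in Ioo a b, |primY c wy (ξ, y)|) := by
    filter_upwards [ae_slice_snd hwB, ae_slice_snd hwA,
      ae_integrable_slice_snd (memLp_integrableOn mX),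
      ae_integrable_slice_snd (memLp_integrableOn mY)] with y h1 h2 h3 h4
    have e : ∫ x in Ioo a b, (B y + primX a wx (x, y))
        = ∫ x in Ioo a b, (A x + primY c wy (x, y)) := by
      refine integral_congr_ae ?_
      filter_upwards [h1, h2] with x h1 h2
      exact h1.symm.trans h2
    rw [integral_add (integrable_const _) h3, integral_add hA h4, integral_const] at e
    simp only [measureReal_restrict_apply_univ, Real.volume_real_Ioo_of_le hab.le, smul_eq_mul] at e
    have e2 : B y - k = (b - a)⁻¹ * ((∫ x in Ioo a b, primY c wy (x, y))
        - ∫ x in Ioo a b, primX a wx (x, y)) := by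
      rw [hk, ← mul_right_inj' hpos.ne']
      field_simp
      linarith
    rw [e2, abs_mul, abs_of_pos (inv_pos.2 hpos)]
    gcongr
    refine (abs_sub _ _).trans ?_
    rw [add_comm]
    exact add_le_add (abs_setIntegral_slice_le _ y) (abs_setIntegral_slice_le _ y)
  have mXa : MemLp (fun p => |primX a wx p|) 2 (volume.restrict (box a b c d)) := mX.abs
  have hbound : l2norm (box a b c d) (fun p => w p - k)
      ≤ l2norm (box a b c d) (fun p => |primX a wx p| + (b - a)⁻¹ *
          (sliceAbs a b (primX a wx) p + sliceAbs a b (primY c wy) p)) := by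
    refine l2norm_mono (mXa.add ((sX.add sY).const_mul _)) ?_
    filter_upwards [hwB, ae_box_of_ae_snd hBk] with p h1 h2
    rw [h1, show B p.2 + primX a wx p - k = primX a wx p + (B p.2 - k) by ring]
    exact (abs_add_le _ _).trans (add_le_add le_rfl h2)
  have h1 := l2norm_add_le mXa ((sX.add sY).const_mul (b - a)⁻¹)
  simp only [Pi.add_apply] at h1
  rw [l2norm_abs, l2norm_const_mul (b - a)⁻¹, abs_of_pos (inv_pos.2 hpos)] at h1
  have h2 := l2norm_add_le sX sY
  have h3 := l2norm_sliceAbs_le hab.le mX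
  have h4 := l2norm_sliceAbs_le hab.le mY
  have h5 := l2norm_primX_le hab.le h.memLp_x
  have h6 := l2norm_primY_le hcd.le h.memLp_y
  have h7 : (b - a)⁻¹ * l2norm (box a b c d) (fun p => sliceAbs a b (primX a wx) p
      + sliceAbs a b (primY c wy) p)
      ≤ l2norm (box a b c d) (primX a wx) + l2norm (box a b c d) (primY c wy) := by
    rw [inv_mul_le_iff₀ hpos]
    linarith
  have h8 := ReducedMorley.l2norm_sub_mean_le hab hcd h.memLp k
  linarith

end ReducedMorley

namespace ReducedMorley

open Set Filter

variable {a b c d : ℝ} {u g w wx wy : ℝ × ℝ → ℝ}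

theorem memLp_of_comp_snd (hab : a < b) {B : ℝ → ℝ} (hB : IntegrableOn B (Ioo c d))
    (h : MemLp (fun p : ℝ × ℝ => B p.2) 2 (volume.restrict (box a b c d))) :
    MemLp B 2 (volume.restrict (Ioo c d)) := by
  have h2 := h.integrable_sq
  rw [restrict_box] at h2
  have : NeBot (ae (volume.restrict (Ioo a b))) := by
    rw [ae_restrict_neBot]; simpa using hab
  obtain ⟨x, hx⟩ := h2.prod_right_ae.exists
  exact (memLp_two_iff_integrable_sq hB.1).2 hx

theorem integrableOn_Ioo_mul {B : ℝ → ℝ} (hB : IntegrableOn B (Ioo c d)) {φ : ℝ → ℝ}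
    (hφ : Continuous φ) : IntegrableOn (fun y => B y * φ y) (Ioo c d) := by
  obtain ⟨C, hC⟩ := (isCompact_Icc (a := c) (b := d)).exists_bound_of_continuousOn hφ.continuousOn
  refine Integrable.mul_bdd hB hφ.aestronglyMeasurable (c := C) ?_
  filter_upwards [ae_restrict_mem measurableSet_Ioo] with y hy
  exact hC y (Ioo_subset_Icc_self hy)

theorem integrableOn_slice_integral (hg : IntegrableOn g (box a b c d)) :
    IntegrableOn (fun y => ∫ ξ in Ioo a b, g (ξ, y)) (Ioo c d) := by
  rw [IntegrableOn, restrict_box] at hg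
  exact hg.integral_prod_right

theorem integrableOn_comp_snd {B : ℝ → ℝ} (hB : IntegrableOn B (Ioo c d)) :
    IntegrableOn (fun p : ℝ × ℝ => B p.2) (box a b c d) := by
  rw [IntegrableOn, restrict_box]
  exact Integrable.comp_snd hB _

/-- Green's formula in `x` for a function with explicit boundary values. -/
theorem green_x (hab : a ≤ b) {B : ℝ → ℝ} (hg : IntegrableOn g (box a b c d))
    (hB : IntegrableOn B (Ioo c d))
    (hu : ∀ᵐ p ∂(volume.restrict (box a b c d)), u p = B p.2 + primX a g p)
    {φ : ℝ × ℝ → ℝ} (hφ : ContDiff ℝ ∞ φ) :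
    (∫ p in box a b c d, u p * pdx φ p) + ∫ p in box a b c d, g p * φ p
      = (∫ y in Ioo c d, (B y + ∫ ξ in Ioo a b, g (ξ, y)) * φ (b, y))
        - ∫ y in Ioo c d, B y * φ (a, y) := by
  have hφ' := (contDiff_pdx hφ).continuous
  have cb : Continuous fun y => φ (b, y) := hφ.continuous.comp (by fun_prop)
  have ca : Continuous fun y => φ (a, y) := hφ.continuous.comp (by fun_prop)
  have i1 := integrableOn_box_mul (integrableOn_comp_snd (a := a) (b := b) hB) hφ'
  have i2 := integrableOn_box_mul (integrableOn_primX hg) hφ'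
  have i3 := integrableOn_Ioo_mul hB cb
  have i4 := integrableOn_Ioo_mul hB ca
  have i5 := integrableOn_Ioo_mul (integrableOn_slice_integral hg) cb
  have e1 : ∫ p in box a b c d, u p * pdx φ p
      = (∫ p in box a b c d, B p.2 * pdx φ p) + ∫ p in box a b c d, primX a g p * pdx φ p := by
    rw [← integral_add i1 i2]
    refine integral_congr_ae ?_
    filter_upwards [hu] with p hp
    rw [hp]; ring
  have e2 : ∫ p in box a b c d, B p.2 * pdx φ p
      = (∫ y in Ioo c d, B y * φ (b, y)) - ∫ y in Ioo c d, B y * φ (a, y) := by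
    rw [integral_box_swap i1, ← integral_sub i3 i4]
    refine integral_congr_ae (Eventually.of_forall fun y => ?_)
    simp only
    rw [integral_const_mul, ← mul_sub, ← intervalIntegral_eq_Ioo hab]
    congr 1
    refine intervalIntegral.integral_eq_sub_of_hasDerivAt (fun x _ => deriv_slice_fst hφ x y) ?_
    exact (hφ'.comp (by fun_prop : Continuous fun x : ℝ => (x, y))).intervalIntegrable _ _
  rw [e1, e2, integral_primX_mul_pdx hab hg hφ]
  simp only [add_mul]
  rw [integral_add i3 i5]
  ring

theorem pdx_comp_swap {φ : ℝ × ℝ → ℝ} (h : ContDiff ℝ ∞ φ) :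
    pdx (φ ∘ Prod.swap) = pdy φ ∘ Prod.swap := by
  have h1 := pdy_comp_swap (φ := φ ∘ Prod.swap) (h.comp (contDiff_snd.prodMk contDiff_fst))
  have h2 : (φ ∘ Prod.swap) ∘ Prod.swap = φ := by funext p; simp
  rw [h2] at h1
  rw [h1]
  funext p
  simp

theorem setIntegral_box_comp_swap (f : ℝ × ℝ → ℝ) :
    ∫ p in box c d a b, f p.swap = ∫ p in box a b c d, f p :=
  (measurePreserving_swap_box c d a b).integral_comp measurableEmbedding_swap f

/-- Green's formula in `y` for a function with explicit boundary values. -/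
theorem green_y (hcd : c ≤ d) {A : ℝ → ℝ} (hg : IntegrableOn g (box a b c d))
    (hA : IntegrableOn A (Ioo a b))
    (hu : ∀ᵐ p ∂(volume.restrict (box a b c d)), u p = A p.1 + primY c g p)
    {φ : ℝ × ℝ → ℝ} (hφ : ContDiff ℝ ∞ φ) :
    (∫ p in box a b c d, u p * pdy φ p) + ∫ p in box a b c d, g p * φ p
      = (∫ x in Ioo a b, (A x + ∫ η in Ioo c d, g (x, η)) * φ (x, d))
        - ∫ x in Ioo a b, A x * φ (x, c) := by
  have hu' : ∀ᵐ p ∂(volume.restrict (box c d a b)),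
      (u ∘ Prod.swap) p = A p.2 + primX c (g ∘ Prod.swap) p :=
    (measurePreserving_swap_box c d a b).quasiMeasurePreserving.ae hu
  have h := green_x hcd (integrableOn_comp_swap hg) hA hu'
    (φ := φ ∘ Prod.swap) (hφ.comp (contDiff_snd.prodMk contDiff_fst))
  rw [pdx_comp_swap hφ] at h
  have e1 := setIntegral_box_comp_swap (a := a) (b := b) (c := c) (d := d)
    (fun p => u p * pdy φ p)
  have e2 := setIntegral_box_comp_swap (a := a) (b := b) (c := c) (d := d)
    (fun p => g p * φ p)
  rw [← e1, ← e2]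
  exact h

theorem memLp_slice_integral (hab : a < b) (hg : MemLp g 2 (volume.restrict (box a b c d))) :
    MemLp (fun y => ∫ ξ in Ioo a b, g (ξ, y)) 2 (volume.restrict (Ioo c d)) := by
  have hi := integrableOn_slice_integral (memLp_integrableOn hg)
  refine memLp_of_comp_snd hab hi ?_
  refine (memLp_sliceAbs hg).mono' (integrableOn_comp_snd hi).1 (Eventually.of_forall fun p => ?_)
  exact abs_integral_le_integral_abs

theorem memLp_boundary_x (hab : a < b) {B : ℝ → ℝ}
    (hg : MemLp g 2 (volume.restrict (box a b c d)))
    (hw : MemLp w 2 (volume.restrict (box a b c d))) (hB : IntegrableOn B (Ioo c d))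
    (hu : ∀ᵐ p ∂(volume.restrict (box a b c d)), w p = B p.2 + primX a g p) :
    MemLp B 2 (volume.restrict (Ioo c d)) := by
  refine memLp_of_comp_snd hab hB ?_
  refine (hw.sub (memLp_primX hg)).ae_eq ?_
  filter_upwards [hu] with p hp
  simp [hp]

theorem memLp_boundary_y (hcd : c < d) {A : ℝ → ℝ}
    (hg : MemLp g 2 (volume.restrict (box a b c d)))
    (hw : MemLp w 2 (volume.restrict (box a b c d))) (hA : IntegrableOn A (Ioo a b))
    (hu : ∀ᵐ p ∂(volume.restrict (box a b c d)), w p = A p.1 + primY c g p) :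
    MemLp A 2 (volume.restrict (Ioo a b)) :=
  memLp_boundary_x hcd (memLp_comp_swap hg) (memLp_comp_swap hw) hA
    ((measurePreserving_swap_box c d a b).quasiMeasurePreserving.ae hu)

namespace Rect

variable (K : Rect)

theorem inner_eq_box :
    K.inner = box (K.xc - K.hx) (K.xc + K.hx) (K.yc - K.hy) (K.yc + K.hy) := rfl

theorem x_lt : K.xc - K.hx < K.xc + K.hx := by linarith [K.hx_pos]

theorem y_lt : K.yc - K.hy < K.yc + K.hy := by linarith [K.hy_pos]

theorem exists_isTrace
    (h : IsH1 (K.xc - K.hx) (K.xc + K.hx) (K.yc - K.hy) (K.yc + K.hy) w wx wy) :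
    ∃ τ, K.IsTrace w τ := by
  have hab := K.x_lt
  have hcd := K.y_lt
  have hxe := h.deriv_x.weakDeriv_ae_eq (isOpen_box _ _ _ _)
  have hye := h.deriv_y.weakDeriv_ae_eq (isOpen_box _ _ _ _)
  set a := K.xc - K.hx with ha
  set b := K.xc + K.hx with hb
  set c := K.yc - K.hy with hc
  set d := K.yc + K.hy with hd
  have iw := memLp_integrableOn h.memLp
  have ix := memLp_integrableOn h.memLp_x
  have iy := memLp_integrableOn h.memLp_y
  obtain ⟨B, hB, hwB⟩ := h.deriv_x.exists_eq_add_primX hab hcd iw ix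
  obtain ⟨A, hA, hwA⟩ := h.deriv_y.exists_eq_add_primY hab hcd iw iy
  have mB := memLp_boundary_x hab h.memLp_x h.memLp hB hwB
  have mA := memLp_boundary_y hcd h.memLp_y h.memLp hA hwA
  have mIx := memLp_slice_integral hab h.memLp_x
  have mIy : MemLp (fun x => ∫ η in Ioo c d, wy (x, η)) 2 (volume.restrict (Ioo a b)) :=
    memLp_slice_integral hcd (memLp_comp_swap h.memLp_y)
  classical
  let τ : ℝ × ℝ → ℝ := fun p =>
    if p.1 = a then B p.2 else if p.1 = b then B p.2 + ∫ ξ in Ioo a b, wx (ξ, p.2)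
    else if p.2 = c then A p.1 else A p.1 + ∫ η in Ioo c d, wy (p.1, η)
  have τa : ∀ y, τ (a, y) = B y := fun y => by simp [τ]
  have τb : ∀ y, τ (b, y) = B y + ∫ ξ in Ioo a b, wx (ξ, y) := fun y => by simp [τ, hab.ne']
  have τc : ∀ x ∈ Ioo a b, τ (x, c) = A x := fun x hx => by simp [τ, hx.1.ne', hx.2.ne]
  have τd : ∀ x ∈ Ioo a b, τ (x, d) = A x + ∫ η in Ioo c d, wy (x, η) := fun x hx => by
    simp [τ, hx.1.ne', hx.2.ne, hcd.ne']
  refine ⟨τ, ?_, ?_, ?_, ?_, fun φ hφ => ⟨?_, ?_⟩⟩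
  · refine mA.ae_eq ?_
    filter_upwards [ae_restrict_mem measurableSet_Ioo] with x hx
    exact (τc x hx).symm
  · exact mB.ae_eq (Eventually.of_forall fun y => (τa y).symm)
  · refine (mA.add mIy).ae_eq ?_
    filter_upwards [ae_restrict_mem measurableSet_Ioo] with x hx
    exact (τd x hx).symm
  · exact (mB.add mIx).ae_eq (Eventually.of_forall fun y => (τb y).symm)
  · rw [← hc, ← hd, ← ha, ← hb, intervalIntegral_eq_Ioo hcd.le, intervalIntegral_eq_Ioo hcd.le]
    simp only [τa, τb]
    rw [← green_x hab.le ix hB hwB hφ]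
    congr 1
    refine integral_congr_ae ?_
    filter_upwards [hxe] with p hp
    rw [inner_eq_box, hp]
  · have e1 : ∫ x in Ioo a b, τ (x, d) * φ (x, d)
        = ∫ x in Ioo a b, (A x + ∫ η in Ioo c d, wy (x, η)) * φ (x, d) :=
      setIntegral_congr_fun measurableSet_Ioo fun x hx => by simp only [τd x hx]
    have e2 : ∫ x in Ioo a b, τ (x, c) * φ (x, c) = ∫ x in Ioo a b, A x * φ (x, c) :=
      setIntegral_congr_fun measurableSet_Ioo fun x hx => by simp only [τc x hx]
    rw [← hc, ← hd, ← ha, ← hb, intervalIntegral_eq_Ioo hab.le, intervalIntegral_eq_Ioo hab.le,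
      e1, e2, ← green_y hcd.le iy hA hwA hφ]
    congr 1
    refine integral_congr_ae ?_
    filter_upwards [hye] with p hp
    rw [inner_eq_box, hp]

theorem isTrace_trace
    (h : IsH1 (K.xc - K.hx) (K.xc + K.hx) (K.yc - K.hy) (K.yc + K.hy) w wx wy) :
    K.IsTrace w (K.trace w) := by
  have hex := K.exists_isTrace h
  rw [trace, dif_pos hex]
  exact hex.choose_spec

end Rect

theorem hasFDerivAt_fst_sub (r : ℝ) (p : ℝ × ℝ) :
    HasFDerivAt (fun q : ℝ × ℝ => q.1 - r) (ContinuousLinearMap.fst ℝ ℝ ℝ) p :=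
  hasFDerivAt_fst.sub_const r

theorem hasFDerivAt_snd_sub (r : ℝ) (p : ℝ × ℝ) :
    HasFDerivAt (fun q : ℝ × ℝ => q.2 - r) (ContinuousLinearMap.snd ℝ ℝ ℝ) p :=
  hasFDerivAt_snd.sub_const r

theorem pdx_fst_sub (r : ℝ) : pdx (fun q => q.1 - r) = fun _ => 1 := by
  funext p; simp [pdx, (hasFDerivAt_fst_sub r p).fderiv]

theorem pdy_snd_sub (r : ℝ) : pdy (fun q => q.2 - r) = fun _ => 1 := by
  funext p; simp [pdy, (hasFDerivAt_snd_sub r p).fderiv]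

theorem contDiff_fst_sub (r : ℝ) : ContDiff ℝ ∞ (fun q : ℝ × ℝ => q.1 - r) :=
  contDiff_fst.sub contDiff_const

theorem contDiff_snd_sub (r : ℝ) : ContDiff ℝ ∞ (fun q : ℝ × ℝ => q.2 - r) :=
  contDiff_snd.sub contDiff_const

theorem pdx_const (r : ℝ) : pdx (fun _ => r) = fun _ => 0 := by
  funext p; simp [pdx]

theorem pdy_const (r : ℝ) : pdy (fun _ => r) = fun _ => 0 := by
  funext p; simp [pdy]

namespace Rect

variable (K : Rect)

/-- The integrals of a trace over the right and the left edge. -/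
theorem integral_trace_vertical
    (h : IsH1 (K.xc - K.hx) (K.xc + K.hx) (K.yc - K.hy) (K.yc + K.hy) w wx wy) :
    2 * K.hx * (∫ y in (K.yc - K.hy)..(K.yc + K.hy), K.trace w (K.xc + K.hx, y))
        = (∫ p in K.inner, w p) + (∫ p in K.inner, wx p * (p.1 - K.xc))
          + K.hx * ∫ p in K.inner, wx p ∧
    2 * K.hx * (∫ y in (K.yc - K.hy)..(K.yc + K.hy), K.trace w (K.xc - K.hx, y))
        = (∫ p in K.inner, w p) + (∫ p in K.inner, wx p * (p.1 - K.xc))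
          - K.hx * ∫ p in K.inner, wx p := by
  have ht := (K.isTrace_trace h).2.2.2.2
  have hxe := h.deriv_x.weakDeriv_ae_eq (isOpen_box _ _ _ _)
  have h1 := (ht (fun _ => 1) contDiff_const).1
  have h2 := (ht (fun q => q.1 - K.xc) (contDiff_fst_sub _)).1
  have e1 : ∫ p in K.inner, weakDeriv K.inner 1 0 w p = ∫ p in K.inner, wx p := by
    refine integral_congr_ae ?_
    filter_upwards [hxe] with p hp
    exact hp
  have e2 : ∫ p in K.inner, weakDeriv K.inner 1 0 w p * (p.1 - K.xc)
      = ∫ p in K.inner, wx p * (p.1 - K.xc) := by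
    refine integral_congr_ae ?_
    filter_upwards [hxe] with p hp
    rw [inner_eq_box, hp]
  simp only [pdx_const, mul_zero, integral_zero, zero_add, mul_one, e1] at h1
  rw [pdx_fst_sub, e2] at h2
  simp only [mul_one, add_sub_cancel_left, sub_sub_cancel_left,
    intervalIntegral.integral_mul_const] at h2
  exact ⟨by linear_combination -h2 - K.hx * h1, by linear_combination -h2 + K.hx * h1⟩

/-- The integrals of a trace over the upper and the lower edge. -/
theorem integral_trace_horizontal
    (h : IsH1 (K.xc - K.hx) (K.xc + K.hx) (K.yc - K.hy) (K.yc + K.hy) w wx wy) :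
    2 * K.hy * (∫ x in (K.xc - K.hx)..(K.xc + K.hx), K.trace w (x, K.yc + K.hy))
        = (∫ p in K.inner, w p) + (∫ p in K.inner, wy p * (p.2 - K.yc))
          + K.hy * ∫ p in K.inner, wy p ∧
    2 * K.hy * (∫ x in (K.xc - K.hx)..(K.xc + K.hx), K.trace w (x, K.yc - K.hy))
        = (∫ p in K.inner, w p) + (∫ p in K.inner, wy p * (p.2 - K.yc))
          - K.hy * ∫ p in K.inner, wy p := by
  have ht := (K.isTrace_trace h).2.2.2.2
  have hxe := h.deriv_y.weakDeriv_ae_eq (isOpen_box _ _ _ _)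
  have h1 := (ht (fun _ => 1) contDiff_const).2
  have h2 := (ht (fun q => q.2 - K.yc) (contDiff_snd_sub _)).2
  have e1 : ∫ p in K.inner, weakDeriv K.inner 0 1 w p = ∫ p in K.inner, wy p := by
    refine integral_congr_ae ?_
    filter_upwards [hxe] with p hp
    exact hp
  have e2 : ∫ p in K.inner, weakDeriv K.inner 0 1 w p * (p.2 - K.yc)
      = ∫ p in K.inner, wy p * (p.2 - K.yc) := by
    refine integral_congr_ae ?_
    filter_upwards [hxe] with p hp
    rw [inner_eq_box, hp]
  simp only [pdy_const, mul_zero, integral_zero, zero_add, mul_one, e1] at h1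
  rw [pdy_snd_sub, e2] at h2
  simp only [mul_one, add_sub_cancel_left, sub_sub_cancel_left,
    intervalIntegral.integral_mul_const] at h2
  exact ⟨by linear_combination -h2 - K.hy * h1, by linear_combination -h2 + K.hy * h1⟩

end Rect

end ReducedMorley

namespace ReducedMorley

open Set Filter

variable {a b c d : ℝ} {u g v vx vy : ℝ × ℝ → ℝ}

/-- The integral of `g` over the part of the box below and to the left of a point. -/
noncomputable def primXY (a b c d : ℝ) (g : ℝ × ℝ → ℝ) : ℝ × ℝ → ℝ := fun p =>
  ∫ q in box a b c d, if q.1 ≤ p.1 ∧ q.2 ≤ p.2 then g q else 0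

theorem ae_box_fst_ne (r : ℝ) : ∀ᵐ q ∂(volume.restrict (box a b c d)), q.1 ≠ r :=
  ae_box_of_ae_fst (P := fun x => x ≠ r) (ae_restrict_of_ae (Measure.ae_ne volume r))

theorem ae_box_snd_ne (r : ℝ) : ∀ᵐ q ∂(volume.restrict (box a b c d)), q.2 ≠ r :=
  ae_box_of_ae_snd (P := fun x => x ≠ r) (ae_restrict_of_ae (Measure.ae_ne volume r))

theorem measurableSet_quadrant (p : ℝ × ℝ) :
    MeasurableSet {q : ℝ × ℝ | q.1 ≤ p.1 ∧ q.2 ≤ p.2} :=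
  (measurableSet_le measurable_fst measurable_const).inter
    (measurableSet_le measurable_snd measurable_const)

theorem ite_eq_indicator_quadrant (p : ℝ × ℝ) :
    (fun q : ℝ × ℝ => if q.1 ≤ p.1 ∧ q.2 ≤ p.2 then g q else 0)
      = {q : ℝ × ℝ | q.1 ≤ p.1 ∧ q.2 ≤ p.2}.indicator g := by
  funext q; simp [indicator_apply]

theorem integrableOn_quadrant (hg : IntegrableOn g (box a b c d)) (p : ℝ × ℝ) :
    IntegrableOn (fun q : ℝ × ℝ => if q.1 ≤ p.1 ∧ q.2 ≤ p.2 then g q else 0) (box a b c d) := by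
  rw [ite_eq_indicator_quadrant]
  exact Integrable.indicator hg (measurableSet_quadrant p)

theorem continuous_primXY (hg : IntegrableOn g (box a b c d)) :
    Continuous (primXY a b c d g) := by
  rw [continuous_iff_continuousAt]
  intro p
  refine continuousAt_of_dominated (bound := fun q => |g q|)
    (Eventually.of_forall fun p => (integrableOn_quadrant hg p).1)
    (Eventually.of_forall fun p => Eventually.of_forall fun q => ?_) hg.abs ?_
  · split_ifs <;> simp
  · filter_upwards [ae_box_fst_ne p.1, ae_box_snd_ne p.2] with q h1 h2
    have e : ∀ᶠ p' in nhds p, (q.1 ≤ p'.1 ∧ q.2 ≤ p'.2 ↔ q.1 ≤ p.1 ∧ q.2 ≤ p.2) := by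
      have k : ∀ {r s : ℝ}, r ≠ s → ∀ᶠ t in nhds s, (r ≤ t ↔ r ≤ s) := by
        intro r s hrs
        rcases lt_or_gt_of_ne hrs with h | h
        · filter_upwards [lt_mem_nhds h] with t ht
          exact ⟨fun _ => h.le, fun _ => ht.le⟩
        · filter_upwards [gt_mem_nhds h] with t ht
          exact ⟨fun h' => absurd h' (not_le.2 ht), fun h' => absurd h' (not_le.2 h)⟩
      filter_upwards [continuous_fst.continuousAt.eventually (k h1),
        continuous_snd.continuousAt.eventually (k h2)] with p' e1 e2
      rw [e1, e2]
    refine continuousAt_const.congr (f := fun _ => if q.1 ≤ p.1 ∧ q.2 ≤ p.2 then g q else 0) ?_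
    filter_upwards [e] with p' hp'
    simp only [hp']

theorem primXY_eq_zero {p : ℝ × ℝ} (hp : p.1 ≤ a ∨ p.2 ≤ c) : primXY a b c d g p = 0 := by
  refine setIntegral_eq_zero_of_forall_eq_zero fun q hq => if_neg ?_
  rintro ⟨h1, h2⟩
  rcases hp with h | h
  · exact absurd hq.1.1 (not_lt.2 (h1.trans h))
  · exact absurd hq.2.1 (not_lt.2 (h2.trans h))

theorem primXY_corner : primXY a b c d g (b, d) = ∫ p in box a b c d, g p :=
  setIntegral_congr_fun (isOpen_box a b c d).measurableSet fun _ hq =>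
    if_pos ⟨hq.1.2.le, hq.2.2.le⟩

theorem primXY_eq_primX_primY (hg : IntegrableOn g (box a b c d)) {p : ℝ × ℝ}
    (hp : p ∈ box a b c d) : primXY a b c d g p = primX a (primY c g) p := by
  have hi := integrableOn_quadrant hg p
  rw [primX_eq_of_mem hp, primXY]
  rw [IntegrableOn, restrict_box] at hi
  rw [restrict_box, integral_prod _ hi]
  refine setIntegral_congr_fun measurableSet_Ioo fun ξ hξ => ?_
  simp only
  split_ifs with h
  · have hm : ((p.2, ξ) : ℝ × ℝ) ∈ box c d a b := ⟨hp.2, hξ⟩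
    have e := primX_eq_of_mem (g := g ∘ Prod.swap) hm
    change primY c g (ξ, p.2) = _ at e
    rw [e]
    simp [h]
  · simp [h]

theorem primXY_comp_swap (p : ℝ × ℝ) :
    primXY c d a b (g ∘ Prod.swap) p.swap = primXY a b c d g p := by
  rw [primXY, primXY, ← setIntegral_box_comp_swap]
  simp only [Prod.fst_swap, Prod.snd_swap, Function.comp_apply, Prod.swap_swap, and_comm]

/-- If `vx = A(x) + primY g` then the primitive of `vx` splits accordingly. -/
theorem primX_eq_add_primXY (hab : a < b) (hg : IntegrableOn g (box a b c d)) {A : ℝ → ℝ}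
    (hA : IntegrableOn A (Ioo a b))
    (h : ∀ᵐ p ∂(volume.restrict (box a b c d)), vx p = A p.1 + primY c g p) :
    ∀ᵐ p ∂(volume.restrict (box a b c d)),
      primX a vx p = (∫ ξ in a..p.1, A ξ) + primXY a b c d g p := by
  filter_upwards [ae_box_mem, ae_box_of_ae_snd (ae_slice_snd h),
    ae_box_of_ae_snd (ae_integrable_slice_snd (integrableOn_primY hg))] with p hp h1 h2
  have hsub : uIcc a p.1 ⊆ uIcc a b :=
    uIcc_subset_uIcc (by simp) (by rw [uIcc_of_le hab.le]; exact Ioo_subset_Icc_self hp.1)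
  have iA := (intervalIntegrable_of_integrableOn_Ioo hab.le hA).mono_set hsub
  have iG := (intervalIntegrable_of_integrableOn_Ioo hab.le h2).mono_set hsub
  rw [primXY_eq_primX_primY hg hp, primX, primX, ← intervalIntegral.integral_add iA iG]
  refine intervalIntegral.integral_congr_ae ?_
  rw [uIoc_of_le hp.1.1.le]
  rw [ae_restrict_iff' measurableSet_Ioo] at h1
  filter_upwards [h1] with x hx hx'
  exact hx ⟨hx'.1, hx'.2.trans_lt hp.1.2⟩

theorem primY_eq_add_primXY (hcd : c < d) (hg : IntegrableOn g (box a b c d)) {B : ℝ → ℝ}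
    (hB : IntegrableOn B (Ioo c d))
    (h : ∀ᵐ p ∂(volume.restrict (box a b c d)), vy p = B p.2 + primX a g p) :
    ∀ᵐ p ∂(volume.restrict (box a b c d)),
      primY c vy p = (∫ η in c..p.2, B η) + primXY a b c d g p := by
  have h' := primX_eq_add_primXY (vx := vy ∘ Prod.swap) hcd (integrableOn_comp_swap hg) hB
    ((measurePreserving_swap_box c d a b).quasiMeasurePreserving.ae h)
  filter_upwards [(measurePreserving_swap_box a b c d).quasiMeasurePreserving.ae h'] with p hp
  rw [primXY_comp_swap] at hp
  exact hp

theorem integral_primX (hab : a ≤ b) (hg : IntegrableOn g (box a b c d)) :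
    ∫ p in box a b c d, primX a g p = ∫ p in box a b c d, g p * (b - p.1) := by
  have h := integral_primX_mul_pdx hab hg (contDiff_fst_sub b)
  simp only [pdx_fst_sub, mul_one, sub_self, mul_zero, integral_zero, zero_sub] at h
  rw [h, ← integral_neg]
  congr 1
  funext p
  ring

theorem integral_primY (hcd : c ≤ d) (hg : IntegrableOn g (box a b c d)) :
    ∫ p in box a b c d, primY c g p = ∫ p in box a b c d, g p * (d - p.2) := by
  have h := integral_primX hcd (integrableOn_comp_swap hg)
  rw [← setIntegral_box_comp_swap (a := a) (b := b), ← setIntegral_box_comp_swap (a := a) (b := b)]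
  exact h

theorem integral_box_comp_fst (hcd : c ≤ d) {A : ℝ → ℝ} :
    ∫ p in box a b c d, A p.1 = (d - c) * ∫ x in Ioo a b, A x := by
  rw [restrict_box, integral_fun_fst]
  simp [hcd]

theorem integral_box_comp_snd (hab : a ≤ b) {B : ℝ → ℝ} :
    ∫ p in box a b c d, B p.2 = (b - a) * ∫ x in Ioo c d, B x := by
  rw [restrict_box, integral_fun_snd]
  simp [hab]

theorem integrableOn_comp_fst {A : ℝ → ℝ} (hA : IntegrableOn A (Ioo a b)) :
    IntegrableOn (fun p : ℝ × ℝ => A p.1) (box a b c d) := by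
  rw [IntegrableOn, restrict_box]
  exact Integrable.comp_fst hA _

theorem continuousOn_primitive_Icc (hab : a ≤ b) {A : ℝ → ℝ} (hA : IntegrableOn A (Ioo a b)) :
    ContinuousOn (fun x => ∫ ξ in a..x, A ξ) (Icc a b) := by
  have h := intervalIntegral.continuousOn_primitive_interval (a := a) (b := b) (f := A) (μ := volume)
    (by rw [uIcc_of_le hab, integrableOn_Icc_iff_integrableOn_Ioo]; exact hA)
  rwa [uIcc_of_le hab] at h

/-- A function with two square integrable mixed derivatives is continuous up to the boundary, and
the differences of its values at the vertices are integrals of derivatives over the box. -/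
theorem IsH1.exists_continuousOn (hab : a < b) (hcd : c < d) (hv : IsH1 a b c d v vx vy)
    (hg : IntegrableOn g (box a b c d)) (hxy : IsWeakDeriv (box a b c d) 0 1 vx g)
    (hyx : IsWeakDeriv (box a b c d) 1 0 vy g) :
    ∃ V : ℝ × ℝ → ℝ, ContinuousOn V (Icc a b ×ˢ Icc c d) ∧
      V =ᵐ[volume.restrict (box a b c d)] v ∧
      (d - c) * (V (b, c) - V (a, c))
        = (∫ p in box a b c d, vx p) - ∫ p in box a b c d, g p * (d - p.2) ∧
      (b - a) * (V (a, d) - V (a, c))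
        = (∫ p in box a b c d, vy p) - ∫ p in box a b c d, g p * (b - p.1) ∧
      V (b, d) - V (a, d) - V (b, c) + V (a, c) = ∫ p in box a b c d, g p := by
  have ivx := memLp_integrableOn hv.memLp_x
  have ivy := memLp_integrableOn hv.memLp_y
  have iv := memLp_integrableOn hv.memLp
  obtain ⟨A, hA, hvA⟩ := hxy.exists_eq_add_primY hab hcd ivx hg
  obtain ⟨B, hB, hvB⟩ := hyx.exists_eq_add_primX hab hcd ivy hg
  obtain ⟨B₀, hB₀, hvB₀⟩ := hv.deriv_x.exists_eq_add_primX hab hcd iv ivx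
  obtain ⟨A₀, hA₀, hvA₀⟩ := hv.deriv_y.exists_eq_add_primY hab hcd iv ivy
  have hX := primX_eq_add_primXY hab hg hA hvA
  have hY := primY_eq_add_primXY hcd hg hB hvB
  have hsep : ∀ᵐ p ∂(volume.restrict (box a b c d)),
      B₀ p.2 - (∫ η in c..p.2, B η) = A₀ p.1 - ∫ ξ in a..p.1, A ξ := by
    filter_upwards [hvB₀, hvA₀, hX, hY] with p h1 h2 h3 h4
    rw [h3] at h1
    rw [h4] at h2
    linarith
  have : NeBot (ae (volume.restrict (Ioo a b))) := by
    rw [ae_restrict_neBot]; simpa using hab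
  obtain ⟨x₀, hx₀⟩ := (ae_slice_fst hsep).exists
  set c₀ := A₀ x₀ - ∫ ξ in a..x₀, A ξ
  have hconst := ae_box_of_ae_snd (a := a) (b := b) hx₀
  set V : ℝ × ℝ → ℝ := fun p =>
    c₀ + (∫ ξ in a..p.1, A ξ) + (∫ η in c..p.2, B η) + primXY a b c d g p with hV
  have eA := intervalIntegral_eq_Ioo hab.le (f := A)
  have eB := intervalIntegral_eq_Ioo hcd.le (f := B)
  have Vac : V (a, c) = c₀ := by simp [hV, primXY_eq_zero]
  have Vbc : V (b, c) = c₀ + ∫ x in Ioo a b, A x := by simp [hV, primXY_eq_zero, eA]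
  have Vad : V (a, d) = c₀ + ∫ y in Ioo c d, B y := by simp [hV, primXY_eq_zero, eB]
  have Vbd : V (b, d) = c₀ + (∫ x in Ioo a b, A x) + (∫ y in Ioo c d, B y)
      + ∫ p in box a b c d, g p := by simp only [hV, primXY_corner, eA, eB]
  refine ⟨V, ?_, ?_, ?_, ?_, ?_⟩
  · have h1 := (continuousOn_primitive_Icc hab.le hA).comp
      (continuousOn_fst (s := Icc a b ×ˢ Icc c d)) fun p hp => hp.1
    have h2 := (continuousOn_primitive_Icc hcd.le hB).comp
      (continuousOn_snd (s := Icc a b ×ˢ Icc c d)) fun p hp => hp.2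
    exact ((continuousOn_const.add h1).add h2).add (continuous_primXY hg).continuousOn
  · filter_upwards [hvB₀, hX, hconst] with p h1 h2 h3
    rw [h1, h2]
    simp only [hV]
    linarith
  · have e : ∫ p in box a b c d, vx p = (d - c) * (∫ x in Ioo a b, A x)
        + ∫ p in box a b c d, g p * (d - p.2) := by
      rw [integral_congr_ae hvA, integral_add (integrableOn_comp_fst hA) (integrableOn_primY hg),
        integral_box_comp_fst hcd.le, integral_primY hcd.le hg]
    rw [e, Vbc, Vac]; ring
  · have e : ∫ p in box a b c d, vy p = (b - a) * (∫ y in Ioo c d, B y)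
        + ∫ p in box a b c d, g p * (b - p.1) := by
      rw [integral_congr_ae hvB, integral_add (integrableOn_comp_snd hB) (integrableOn_primX hg),
        integral_box_comp_snd hab.le, integral_primX hab.le hg]
    rw [e, Vad, Vac]; ring
  · rw [Vbd, Vad, Vbc, Vac]; ring

theorem Rect.contRep_eqOn (K : Rect) {V : ℝ × ℝ → ℝ} (hV : ContinuousOn V K.closed)
    (hVv : V =ᵐ[volume.restrict K.inner] v) : EqOn (K.contRep v) V K.closed := by
  have hex : ∃ w : ℝ × ℝ → ℝ, ContinuousOn w K.closed ∧ w =ᵐ[volume.restrict K.inner] v :=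
    ⟨V, hV, hVv⟩
  rw [contRep, dif_pos hex]
  have hW := hex.choose_spec
  set W := hex.choose
  have hae : W =ᵐ[volume.restrict K.inner] V := hW.2.trans hVv.symm
  have hsub : K.inner ⊆ K.closed := prod_mono Ioo_subset_Icc_self Ioo_subset_Icc_self
  have hcl : K.closed ⊆ closure K.inner := by
    rw [inner, closure_prod_eq, closure_Ioo K.x_lt.ne, closure_Ioo K.y_lt.ne]
    exact subset_rfl
  have h1 : EqOn W V K.inner :=
    Measure.eqOn_open_of_ae_eq hae (isOpen_box _ _ _ _) (hW.1.mono hsub) (hV.mono hsub)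
  exact h1.of_subset_closure hW.1 hV hsub hcl

end ReducedMorley

namespace ReducedMorley

open Set Filter

/-- The quadratic polynomials in coordinates centred at `(x₀, y₀)`. -/
def quad (x₀ y₀ c₀ c₁ c₂ c₃ c₄ c₅ : ℝ) : ℝ × ℝ → ℝ := fun p =>
  c₀ + c₁ * (p.1 - x₀) + c₂ * (p.2 - y₀) + c₃ * ((p.1 - x₀) * (p.2 - y₀)) + c₄ * (p.1 - x₀) ^ 2
    + c₅ * (p.2 - y₀) ^ 2

variable {x₀ y₀ c₀ c₁ c₂ c₃ c₄ c₅ : ℝ}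

theorem contDiff_quad : ContDiff ℝ ∞ (quad x₀ y₀ c₀ c₁ c₂ c₃ c₄ c₅) := by
  unfold quad; fun_prop

theorem pdx_quad : pdx (quad x₀ y₀ c₀ c₁ c₂ c₃ c₄ c₅) = quad x₀ y₀ c₁ (2 * c₄) c₃ 0 0 0 := by
  funext p
  have h := deriv_slice_fst (contDiff_quad (x₀ := x₀) (y₀ := y₀) (c₀ := c₀) (c₁ := c₁) (c₂ := c₂)
    (c₃ := c₃) (c₄ := c₄) (c₅ := c₅)) p.1 p.2
  have hX : HasDerivAt (fun x : ℝ => x - x₀) 1 p.1 := (hasDerivAt_id p.1).sub_const x₀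
  have h' := ((((((hasDerivAt_const p.1 c₀).add (hX.const_mul c₁)).add
    (hasDerivAt_const p.1 (c₂ * (p.2 - y₀)))).add ((hX.mul_const (p.2 - y₀)).const_mul c₃)).add
    ((hX.pow 2).const_mul c₄)).add (hasDerivAt_const p.1 (c₅ * (p.2 - y₀) ^ 2)))
  refine (h.unique h').trans ?_
  simp only [quad]
  push_cast
  ring

theorem quad_comp_swap : quad x₀ y₀ c₀ c₁ c₂ c₃ c₄ c₅ ∘ Prod.swap
    = quad y₀ x₀ c₀ c₂ c₁ c₃ c₅ c₄ := by
  funext p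
  simp only [quad, Function.comp_apply, Prod.fst_swap, Prod.snd_swap]
  ring

theorem pdy_quad : pdy (quad x₀ y₀ c₀ c₁ c₂ c₃ c₄ c₅) = quad x₀ y₀ c₂ c₃ (2 * c₅) 0 0 0 := by
  have h := pdy_comp_swap (contDiff_quad (x₀ := y₀) (y₀ := x₀) (c₀ := c₀) (c₁ := c₂) (c₂ := c₁)
    (c₃ := c₃) (c₄ := c₅) (c₅ := c₄))
  rwa [quad_comp_swap, pdx_quad, quad_comp_swap] at h

namespace Rect

variable (K : Rect) {v w wx wy f : ℝ × ℝ → ℝ} {i j k : ℕ}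

instance isFiniteMeasure_inner : IsFiniteMeasure (volume.restrict K.inner : Measure (ℝ × ℝ)) :=
  isFiniteMeasure_box _ _ _ _

theorem isOpen_inner : IsOpen K.inner := isOpen_box _ _ _ _

/-- The mean value over the rectangle. -/
noncomputable def mean (f : ℝ × ℝ → ℝ) : ℝ := (4 * K.hx * K.hy)⁻¹ * ∫ p in K.inner, f p

theorem mean_eq : ReducedMorley.mean (K.xc - K.hx) (K.xc + K.hx) (K.yc - K.hy) (K.yc + K.hy) f
    = K.mean f := by
  rw [mean, ReducedMorley.mean]
  congr 2
  ring

theorem memLp_continuous (hf : Continuous f) : MemLp f 2 (volume.restrict K.inner) := by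
  have hK : IsCompact K.closed := isCompact_Icc.prod isCompact_Icc
  obtain ⟨C, hC⟩ := hK.exists_bound_of_continuousOn hf.continuousOn
  refine MemLp.of_bound hf.aestronglyMeasurable C ?_
  filter_upwards [ae_restrict_mem K.isOpen_inner.measurableSet] with p hp
  exact hC p ⟨Ioo_subset_Icc_self hp.1, Ioo_subset_Icc_self hp.2⟩

theorem memLp_mul_continuous (hf : MemLp f 2 (volume.restrict K.inner)) {φ : ℝ × ℝ → ℝ}
    (hφ : Continuous φ) : MemLp (fun p => f p * φ p) 2 (volume.restrict K.inner) := by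
  have hK : IsCompact K.closed := isCompact_Icc.prod isCompact_Icc
  obtain ⟨C, hC⟩ := hK.exists_bound_of_continuousOn hφ.continuousOn
  refine (hf.const_mul C).mono (hf.1.mul hφ.aestronglyMeasurable) ?_
  filter_upwards [ae_restrict_mem K.isOpen_inner.measurableSet] with p hp
  have h1 : ‖φ p‖ ≤ C := hC p ⟨Ioo_subset_Icc_self hp.1, Ioo_subset_Icc_self hp.2⟩
  rw [norm_mul, norm_mul, mul_comm]
  gcongr
  exact h1.trans (le_abs_self C)

theorem integral_fst_sub : ∫ p in K.inner, (p.1 - K.xc) = 0 := by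
  rw [inner_eq_box, integral_box_comp_fst K.y_lt.le (A := fun x => x - K.xc),
    ← intervalIntegral_eq_Ioo K.x_lt.le, intervalIntegral.integral_comp_sub_right (fun x => x)]
  simp

theorem integral_snd_sub : ∫ p in K.inner, (p.2 - K.yc) = 0 := by
  rw [inner_eq_box, integral_box_comp_snd K.x_lt.le (B := fun x => x - K.yc),
    ← intervalIntegral_eq_Ioo K.y_lt.le, intervalIntegral.integral_comp_sub_right (fun x => x)]
  simp

/-- `w ∈ H¹(K)` with weak first derivatives `wx` and `wy`. -/
abbrev IsH1 (w wx wy : ℝ × ℝ → ℝ) : Prop :=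
  ReducedMorley.IsH1 (K.xc - K.hx) (K.xc + K.hx) (K.yc - K.hy) (K.yc + K.hy) w wx wy

variable {K}

theorem IsH1.poincare (h : K.IsH1 w wx wy) : l2norm K.inner (fun p => w p - K.mean w)
    ≤ 8 * (K.hx * l2norm K.inner wx + K.hy * l2norm K.inner wy) := by
  have h1 := h.l2norm_sub_mean_le K.x_lt K.y_lt
  rw [mean_eq, ← inner_eq_box] at h1
  have h2 := mul_nonneg K.hy_pos.le (l2norm_nonneg (U := K.inner) (f := wy))
  nlinarith

theorem l2norm_sub_mean_le (hf : MemLp f 2 (volume.restrict K.inner)) :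
    l2norm K.inner (fun p => f p - K.mean f) ≤ 2 * l2norm K.inner f := by
  have h := ReducedMorley.l2norm_sub_mean_le K.x_lt K.y_lt hf 0
  simpa only [sub_zero, mean_eq, ← inner_eq_box] using h

theorem l2norm_const_mean_mul_le (hf : MemLp f 2 (volume.restrict K.inner)) {φ : ℝ × ℝ → ℝ}
    (hφ : Continuous φ) {r : ℝ} (hr : ∀ p ∈ K.inner, |φ p| ≤ r) (hr0 : 0 ≤ r) :
    l2norm K.inner (fun _ => K.mean fun p => f p * φ p) ≤ r * l2norm K.inner f := by
  have h := l2norm_const_mean_le K.x_lt K.y_lt (K.memLp_mul_continuous hf hφ)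
  rw [mean_eq, ← inner_eq_box] at h
  refine h.trans ?_
  have hfa : MemLp (fun p => r * |f p|) 2 (volume.restrict K.inner) := hf.abs.const_mul r
  have h2 : l2norm K.inner (fun p => f p * φ p) ≤ l2norm K.inner (fun p => r * |f p|) := by
    refine l2norm_mono hfa ?_
    filter_upwards [ae_restrict_mem K.isOpen_inner.measurableSet] with p hp
    rw [abs_mul, mul_comm]
    gcongr
    exact hr p hp
  rwa [l2norm_const_mul r (f := fun p => |f p|), l2norm_abs, abs_of_nonneg hr0] at h2

theorem mean_sub_mul (hf : MemLp f 2 (volume.restrict K.inner)) {φ : ℝ × ℝ → ℝ}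
    (hφ : Continuous φ) (h0 : ∫ p in K.inner, φ p = 0) (r : ℝ) :
    K.mean (fun p => (f p - r) * φ p) = K.mean fun p => f p * φ p := by
  have i1 : Integrable (fun p => f p * φ p) (volume.restrict K.inner) :=
    (K.memLp_mul_continuous hf hφ).integrable one_le_two
  have i2 : Integrable (fun p => r * φ p) (volume.restrict K.inner) :=
    ((K.memLp_continuous hφ).const_mul r).integrable one_le_two
  rw [mean, mean]
  simp only [sub_mul]
  rw [integral_sub i1 i2, integral_const_mul, h0, mul_zero, sub_zero]

theorem IsH1.sub_quad (h : K.IsH1 w wx wy) (x₀ y₀ α β : ℝ) :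
    K.IsH1 (fun p => w p - quad x₀ y₀ 0 α β 0 0 0 p) (fun p => wx p - α) (fun p => wy p - β) := by
  have hq : ContDiff ℝ ∞ (quad x₀ y₀ 0 α β 0 0 0) := contDiff_quad
  refine ⟨h.memLp.sub (K.memLp_continuous hq.continuous), h.memLp_x.sub (memLp_const α),
    h.memLp_y.sub (memLp_const β), ?_, ?_⟩
  · have h1 := h.deriv_x.sub (isWeakDeriv_of_contDiff hq K.inner 1 0)
    simp only [Function.iterate_one, Function.iterate_zero, id, pdx_quad] at h1
    have e : wx - quad x₀ y₀ α (2 * 0) 0 0 0 0 = fun p => wx p - α := by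
      funext p; simp [quad]
    rwa [e] at h1
  · have h1 := h.deriv_y.sub (isWeakDeriv_of_contDiff hq K.inner 0 1)
    simp only [Function.iterate_one, Function.iterate_zero, id, pdy_quad] at h1
    have e : wy - quad x₀ y₀ β 0 (2 * 0) 0 0 0 = fun p => wy p - β := by
      funext p; simp [quad]
    rwa [e] at h1

/-- The error of the affine approximations of `w ∈ H¹(K)` by which the interpolant acts on first
derivatives. -/
theorem IsH1.l2norm_sub_affine_le (h : K.IsH1 w wx wy) {κ₁ κ₂ : ℝ} (hκ₁ : |κ₁| ≤ 2)
    (hκ₂ : |κ₂| ≤ 2) :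
    l2norm K.inner (fun p => w p - quad K.xc K.yc
        (K.mean w + κ₁ * K.mean (fun p => wx p * (p.1 - K.xc))
          + κ₂ * K.mean (fun p => wy p * (p.2 - K.yc))) (K.mean wx) (K.mean wy) 0 0 0 p)
      ≤ 10 * (K.hx * l2norm K.inner (fun p => wx p - K.mean wx)
        + K.hy * l2norm K.inner (fun p => wy p - K.mean wy)) := by
  have cx : Continuous fun p : ℝ × ℝ => p.1 - K.xc := by fun_prop
  have cy : Continuous fun p : ℝ × ℝ => p.2 - K.yc := by fun_prop
  set q := quad K.xc K.yc 0 (K.mean wx) (K.mean wy) 0 0 0 with hq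
  have hr := h.sub_quad K.xc K.yc (K.mean wx) (K.mean wy)
  rw [← hq] at hr
  have hqc : Continuous q := contDiff_quad.continuous
  have hmq : ∫ p in K.inner, q p = 0 := by
    have e : ∀ p, q p = K.mean wx * (p.1 - K.xc) + K.mean wy * (p.2 - K.yc) := fun p => by
      simp [hq, quad]
    have i1 : Integrable (fun p : ℝ × ℝ => K.mean wx * (p.1 - K.xc)) (volume.restrict K.inner) :=
      ((K.memLp_continuous cx).const_mul _).integrable one_le_two
    have i2 : Integrable (fun p : ℝ × ℝ => K.mean wy * (p.2 - K.yc)) (volume.restrict K.inner) :=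
      ((K.memLp_continuous cy).const_mul _).integrable one_le_two
    simp only [e]
    rw [integral_add i1 i2, integral_const_mul, integral_const_mul, integral_fst_sub,
      integral_snd_sub]
    simp
  have hmr : K.mean (fun p => w p - q p) = K.mean w := by
    have iw : Integrable w (volume.restrict K.inner) := memLp_integrableOn h.memLp
    have iq : Integrable q (volume.restrict K.inner) :=
      (K.memLp_continuous hqc).integrable one_le_two
    rw [mean, mean, integral_sub iw iq, hmq, sub_zero]
  have hP := hr.poincare
  rw [hmr] at hP
  set M₁ := K.mean (fun p => wx p * (p.1 - K.xc)) with hM₁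
  set M₂ := K.mean (fun p => wy p * (p.2 - K.yc)) with hM₂
  have h1 : l2norm K.inner (fun _ => M₁)
      ≤ K.hx * l2norm K.inner (fun p => wx p - K.mean wx) := by
    rw [hM₁, ← mean_sub_mul h.memLp_x cx K.integral_fst_sub (K.mean wx)]
    refine l2norm_const_mean_mul_le hr.memLp_x cx (fun p hp => ?_) K.hx_pos.le
    rw [abs_le]; constructor <;> linarith [hp.1.1, hp.1.2]
  have h2 : l2norm K.inner (fun _ => M₂)
      ≤ K.hy * l2norm K.inner (fun p => wy p - K.mean wy) := by
    rw [hM₂, ← mean_sub_mul h.memLp_y cy K.integral_snd_sub (K.mean wy)]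
    refine l2norm_const_mean_mul_le hr.memLp_y cy (fun p hp => ?_) K.hy_pos.le
    rw [abs_le]; constructor <;> linarith [hp.2.1, hp.2.2]
  have e : (fun p => w p - quad K.xc K.yc (K.mean w + κ₁ * M₁ + κ₂ * M₂) (K.mean wx) (K.mean wy)
      0 0 0 p) = fun p => (w p - q p - K.mean w) + (-κ₁ * M₁ + -κ₂ * M₂) := by
    funext p
    simp only [hq, quad]
    ring
  have m1 : MemLp (fun p => w p - q p - K.mean w) 2 (volume.restrict K.inner) :=
    hr.memLp.sub (memLp_const _)
  have t1 := l2norm_add_le m1 (memLp_const (-κ₁ * M₁ + -κ₂ * M₂))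
  have t2 := l2norm_add_le (U := K.inner) (memLp_const (-κ₁ * M₁)) (memLp_const (-κ₂ * M₂))
  rw [l2norm_const_mul (-κ₁) (f := fun _ => M₁), l2norm_const_mul (-κ₂) (f := fun _ => M₂),
    abs_neg, abs_neg] at t2
  rw [e]
  have p1 : |κ₁| * l2norm K.inner (fun _ => M₁)
      ≤ 2 * (K.hx * l2norm K.inner (fun p => wx p - K.mean wx)) :=
    mul_le_mul hκ₁ h1 l2norm_nonneg (by norm_num)
  have p2 : |κ₂| * l2norm K.inner (fun _ => M₂)
      ≤ 2 * (K.hy * l2norm K.inner (fun p => wy p - K.mean wy)) :=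
    mul_le_mul hκ₂ h2 l2norm_nonneg (by norm_num)
  linarith

end Rect

section MemH

variable {U : Set (ℝ × ℝ)} {v f : ℝ × ℝ → ℝ} {i j k : ℕ}

theorem MemH.isWeakDeriv (h : MemH U k v) (hij : i + j ≤ k) :
    IsWeakDeriv U i j v (weakDeriv U i j v) := by
  obtain ⟨g, hg, -⟩ := h.2 i j hij
  exact hg.weakDeriv

theorem MemH.memLp_weakDeriv (hU : IsOpen U) (h : MemH U k v) (hij : i + j ≤ k) :
    MemLp (weakDeriv U i j v) 2 (volume.restrict U) := by
  obtain ⟨g, hg, hg2⟩ := h.2 i j hij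
  exact hg2.ae_eq (hg.weakDeriv_ae_eq hU).symm

theorem MemH.mono (h : MemH U k v) {l : ℕ} (hl : l ≤ k) : MemH U l v :=
  ⟨h.1, fun i j hij => h.2 i j (hij.trans hl)⟩

theorem MemH.sub (h : MemH U k v) (h' : MemH U k f) : MemH U k (v - f) := by
  refine ⟨h.1.sub h'.1, fun i j hij => ?_⟩
  obtain ⟨g, hg, hg2⟩ := h.2 i j hij
  obtain ⟨g', hg', hg2'⟩ := h'.2 i j hij
  exact ⟨g - g', hg.sub hg', hg2.sub hg2'⟩

end MemH

namespace Rect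

variable {K : Rect} {v f : ℝ × ℝ → ℝ} {i j k : ℕ}

theorem memH_of_contDiff (hf : ContDiff ℝ ∞ f) (k : ℕ) : MemH K.inner k f :=
  ⟨K.memLp_continuous hf.continuous, fun i j _ => ⟨_, isWeakDeriv_of_contDiff hf _ i j,
    K.memLp_continuous (contDiff_iterate_pdy (contDiff_iterate_pdx hf i) j).continuous⟩⟩

theorem dnorm_sub_eq (hv : MemH K.inner k v) (hf : ContDiff ℝ ∞ f) (hij : i + j ≤ k) :
    K.dnorm i j (v - f)
      = l2norm K.inner (fun p => weakDeriv K.inner i j v p - (pdy^[j] (pdx^[i] f)) p) :=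
  l2norm_congr (((hv.isWeakDeriv hij).sub
    (isWeakDeriv_of_contDiff hf _ i j)).weakDeriv_ae_eq K.isOpen_inner)

/-- The weak derivatives of `v ∈ H^k(K)` of order less than `k` belong to `H¹(K)`. -/
theorem isH1_weakDeriv (hv : MemH K.inner k v) (hij : i + j + 1 ≤ k) :
    K.IsH1 (weakDeriv K.inner i j v) (weakDeriv K.inner (i + 1) j v)
      (weakDeriv K.inner i (j + 1) v) where
  memLp := hv.memLp_weakDeriv K.isOpen_inner (by omega)
  memLp_x := hv.memLp_weakDeriv K.isOpen_inner (by omega)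
  memLp_y := hv.memLp_weakDeriv K.isOpen_inner (by omega)
  deriv_x := (hv.isWeakDeriv (by omega)).pdx_of_succ (hv.isWeakDeriv (by omega))
  deriv_y := (hv.isWeakDeriv (by omega)).pdy_of_succ (hv.isWeakDeriv (by omega))

/-- `v ∈ H¹(K)` in terms of its own first weak derivatives. -/
theorem isH1_self (hv : MemH K.inner k v) (hk : 1 ≤ k) :
    K.IsH1 v (weakDeriv K.inner 1 0 v) (weakDeriv K.inner 0 1 v) where
  memLp := hv.1
  memLp_x := hv.memLp_weakDeriv K.isOpen_inner (by omega)
  memLp_y := hv.memLp_weakDeriv K.isOpen_inner (by omega)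
  deriv_x := hv.isWeakDeriv (by omega)
  deriv_y := hv.isWeakDeriv (by omega)

/-- The reduced Morley interpolant as a quadratic polynomial whose coefficients are means of
derivatives. -/
theorem interp_eq_quad (hv : MemH K.inner 2 v) : ∃ c₀, K.interp v = quad K.xc K.yc c₀
    (K.mean (weakDeriv K.inner 1 0 v)
      + -1 / 2 * K.mean (fun p => weakDeriv K.inner 2 0 v p * (p.1 - K.xc))
      + 3 / 2 * K.mean (fun p => weakDeriv K.inner 1 1 v p * (p.2 - K.yc)))
    (K.mean (weakDeriv K.inner 0 1 v)
      + 3 / 2 * K.mean (fun p => weakDeriv K.inner 1 1 v p * (p.1 - K.xc))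
      + -1 / 2 * K.mean (fun p => weakDeriv K.inner 0 2 v p * (p.2 - K.yc)))
    (K.mean (weakDeriv K.inner 1 1 v)) (K.mean (weakDeriv K.inner 2 0 v) / 2)
    (K.mean (weakDeriv K.inner 0 2 v) / 2) := by
  have hx := K.hx_pos
  have hy := K.hy_pos
  have h10 := isH1_weakDeriv (i := 1) (j := 0) hv le_rfl
  have h01 := isH1_weakDeriv (i := 0) (j := 1) hv le_rfl
  have ig : IntegrableOn (weakDeriv K.inner 1 1 v) K.inner := memLp_integrableOn h10.memLp_y
  obtain ⟨V, hVc, hVv, hV1, hV2, hV3⟩ := (isH1_self hv (by omega)).exists_continuousOn K.x_lt K.y_lt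
    ig h10.deriv_y h01.deriv_x
  have hrep := K.contRep_eqOn hVc hVv
  have mem : ∀ x y, (x = K.xc - K.hx ∨ x = K.xc + K.hx) → (y = K.yc - K.hy ∨ y = K.yc + K.hy) →
      K.contRep v (x, y) = V (x, y) := by
    intro x y h1 h2
    refine hrep ⟨?_, ?_⟩
    · rcases h1 with rfl | rfl
      · exact left_mem_Icc.2 K.x_lt.le
      · exact right_mem_Icc.2 K.x_lt.le
    · rcases h2 with rfl | rfl
      · exact left_mem_Icc.2 K.y_lt.le
      · exact right_mem_Icc.2 K.y_lt.le
  obtain ⟨hR, hL⟩ := K.integral_trace_vertical h10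
  obtain ⟨hT, hB⟩ := K.integral_trace_horizontal h01
  have split : ∀ (r : ℝ) (φ : ℝ × ℝ → ℝ), Continuous φ →
      ∫ p in K.inner, weakDeriv K.inner 1 1 v p * (r - φ p)
        = r * (∫ p in K.inner, weakDeriv K.inner 1 1 v p)
          - ∫ p in K.inner, weakDeriv K.inner 1 1 v p * φ p := by
    intro r φ hφ
    have i1 : IntegrableOn (fun p => weakDeriv K.inner 1 1 v p * φ p) K.inner :=
      integrableOn_box_mul ig hφ
    rw [← integral_const_mul, ← integral_sub (ig.const_mul r) i1]
    congr 1
    funext p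
    ring
  have s1 := split K.hy (fun p => p.2 - K.yc) (by fun_prop)
  have s2 := split K.hx (fun p => p.1 - K.xc) (by fun_prop)
  have r1 : ∀ y : ℝ, K.yc + K.hy - y = K.hy - (y - K.yc) := fun y => by ring
  have r2 : ∀ x : ℝ, K.xc + K.hx - x = K.hx - (x - K.xc) := fun x => by ring
  simp only [r1, r2, ← inner_eq_box, s1, s2] at hV1 hV2 hV3
  have v1 : K.contRep v (K.vertex 0) = V (K.xc - K.hx, K.yc - K.hy) :=
    mem _ _ (Or.inl rfl) (Or.inl rfl)
  have v2 : K.contRep v (K.vertex 1) = V (K.xc - K.hx, K.yc + K.hy) :=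
    mem _ _ (Or.inl rfl) (Or.inr rfl)
  have v3 : K.contRep v (K.vertex 2) = V (K.xc + K.hx, K.yc + K.hy) :=
    mem _ _ (Or.inr rfl) (Or.inr rfl)
  have v4 : K.contRep v (K.vertex 3) = V (K.xc + K.hx, K.yc - K.hy) :=
    mem _ _ (Or.inr rfl) (Or.inl rfl)
  have n1 : K.normalMean v 0 = 1 / (2 * K.hx) * -∫ x in (K.xc - K.hx)..(K.xc + K.hx),
      K.trace (weakDeriv K.inner 0 1 v) (x, K.yc - K.hy) := by
    rw [← intervalIntegral.integral_neg]; rfl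
  have n2 : K.normalMean v 1 = 1 / (2 * K.hy) * -∫ y in (K.yc - K.hy)..(K.yc + K.hy),
      K.trace (weakDeriv K.inner 1 0 v) (K.xc - K.hx, y) := by
    rw [← intervalIntegral.integral_neg]; rfl
  have n3 : K.normalMean v 2 = 1 / (2 * K.hx) * ∫ x in (K.xc - K.hx)..(K.xc + K.hx),
      K.trace (weakDeriv K.inner 0 1 v) (x, K.yc + K.hy) := rfl
  have n4 : K.normalMean v 3 = 1 / (2 * K.hy) * ∫ y in (K.yc - K.hy)..(K.yc + K.hy),
      K.trace (weakDeriv K.inner 1 0 v) (K.xc + K.hx, y) := rfl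
  set V₁ := V (K.xc - K.hx, K.yc - K.hy)
  set V₂ := V (K.xc - K.hx, K.yc + K.hy)
  set V₃ := V (K.xc + K.hx, K.yc + K.hy)
  set V₄ := V (K.xc + K.hx, K.yc - K.hy)
  set T₁ := ∫ x in (K.xc - K.hx)..(K.xc + K.hx),
      K.trace (weakDeriv K.inner 0 1 v) (x, K.yc - K.hy)
  set T₂ := ∫ y in (K.yc - K.hy)..(K.yc + K.hy),
      K.trace (weakDeriv K.inner 1 0 v) (K.xc - K.hx, y)
  set T₃ := ∫ x in (K.xc - K.hx)..(K.xc + K.hx),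
      K.trace (weakDeriv K.inner 0 1 v) (x, K.yc + K.hy)
  set T₄ := ∫ y in (K.yc - K.hy)..(K.yc + K.hy),
      K.trace (weakDeriv K.inner 1 0 v) (K.xc + K.hx, y)
  refine ⟨(V₁ + V₂ + V₃ + V₄) / 4 - K.hy / 4 * (1 / (2 * K.hx) * (T₃ - T₁))
    - K.hx / 4 * (1 / (2 * K.hy) * (T₄ - T₂)), ?_⟩
  funext z
  simp only [interp, Fin.sum_univ_four, v1, v2, v3, v4, n1, n2, n3, n4]
  simp only [pRed, qRed, quad, mean, Matrix.cons_val]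
  set G := ∫ p in K.inner, weakDeriv K.inner 1 1 v p
  set Gx := ∫ p in K.inner, weakDeriv K.inner 1 1 v p * (p.1 - K.xc)
  set Gy := ∫ p in K.inner, weakDeriv K.inner 1 1 v p * (p.2 - K.yc)
  set W := ∫ p in K.inner, weakDeriv K.inner 1 0 v p
  set Z := ∫ p in K.inner, weakDeriv K.inner 0 1 v p
  set P := ∫ p in K.inner, weakDeriv K.inner 2 0 v p
  set Px := ∫ p in K.inner, weakDeriv K.inner 2 0 v p * (p.1 - K.xc)
  set Q := ∫ p in K.inner, weakDeriv K.inner 0 2 v p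
  set Qy := ∫ p in K.inner, weakDeriv K.inner 0 2 v p * (p.2 - K.yc)
  have eV₄ : V₄ = V₁ + (W - (K.hy * G - Gy)) / (2 * K.hy) := by
    field_simp; linear_combination hV1
  have eV₂ : V₂ = V₁ + (Z - (K.hx * G - Gx)) / (2 * K.hx) := by
    field_simp; linear_combination hV2
  have eV₃ : V₃ = G + V₂ + V₄ - V₁ := by linear_combination hV3
  have eT₁ : T₁ = (Z + Qy - K.hy * Q) / (2 * K.hy) := by
    field_simp; linear_combination hB
  have eT₂ : T₂ = (W + Px - K.hx * P) / (2 * K.hx) := by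
    field_simp; linear_combination hL
  have eT₃ : T₃ = (Z + Qy + K.hy * Q) / (2 * K.hy) := by
    field_simp; linear_combination hT
  have eT₄ : T₄ = (W + Px + K.hx * P) / (2 * K.hx) := by
    field_simp; linear_combination hR
  rw [eV₃, eV₂, eV₄, eT₁, eT₂, eT₃, eT₄]
  field_simp
  ring

/-- The derivatives of the interpolation error. -/
theorem dnorm_sub_interp_first (hv : MemH K.inner 2 v) :
    K.dnorm 1 0 (v - K.interp v)
      ≤ 10 * (K.hx * l2norm K.inner
          (fun p => weakDeriv K.inner 2 0 v p - K.mean (weakDeriv K.inner 2 0 v))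
        + K.hy * l2norm K.inner
          (fun p => weakDeriv K.inner 1 1 v p - K.mean (weakDeriv K.inner 1 1 v))) ∧
    K.dnorm 0 1 (v - K.interp v)
      ≤ 10 * (K.hx * l2norm K.inner
          (fun p => weakDeriv K.inner 1 1 v p - K.mean (weakDeriv K.inner 1 1 v))
        + K.hy * l2norm K.inner
          (fun p => weakDeriv K.inner 0 2 v p - K.mean (weakDeriv K.inner 0 2 v))) := by
  obtain ⟨c₀, hc₀⟩ := interp_eq_quad hv
  have k1 : |(-1 / 2 : ℝ)| ≤ 2 := by norm_num [abs_le]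
  have k2 : |(3 / 2 : ℝ)| ≤ 2 := by norm_num [abs_le]
  have half : ∀ r : ℝ, 2 * (r / 2) = r := fun r => by ring
  rw [hc₀, dnorm_sub_eq hv contDiff_quad (by norm_num), dnorm_sub_eq hv contDiff_quad (by norm_num)]
  simp only [Function.iterate_one, Function.iterate_zero, id, pdx_quad, pdy_quad, half]
  exact ⟨(isH1_weakDeriv (i := 1) (j := 0) hv le_rfl).l2norm_sub_affine_le k1 k2,
    (isH1_weakDeriv (i := 0) (j := 1) hv le_rfl).l2norm_sub_affine_le k2 k1⟩

theorem dnorm_sub_interp_second (hv : MemH K.inner 2 v) (hij : i + j = 2) :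
    K.dnorm i j (v - K.interp v)
      = l2norm K.inner (fun p => weakDeriv K.inner i j v p - K.mean (weakDeriv K.inner i j v)) := by
  obtain ⟨c₀, hc₀⟩ := interp_eq_quad hv
  have half : ∀ r : ℝ, 2 * (r / 2) = r := fun r => by ring
  rw [hc₀, dnorm_sub_eq hv contDiff_quad hij.le]
  obtain ⟨rfl, rfl⟩ | ⟨rfl, rfl⟩ | ⟨rfl, rfl⟩ :
      i = 2 ∧ j = 0 ∨ i = 1 ∧ j = 1 ∨ i = 0 ∧ j = 2 := by omega
  all_goals
    simp only [Function.iterate_succ, Function.iterate_zero, Function.comp_apply, id, pdx_quad,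
      pdy_quad, half]
    simp [quad]

theorem memH_sub_interp (hv : MemH K.inner k v) (hk : 2 ≤ k) :
    MemH K.inner k (v - K.interp v) := by
  obtain ⟨c₀, hc₀⟩ := interp_eq_quad (hv.mono hk)
  rw [hc₀]
  exact hv.sub (memH_of_contDiff contDiff_quad k)

end Rect

end ReducedMorley

theorem lemma4p9 :
    ∃ C : ℝ, 0 < C ∧ ∀ K : ReducedMorley.Rect,
      (∀ v : ℝ × ℝ → ℝ, ReducedMorley.MemH K.inner 2 v →
        ReducedMorley.MemH K.inner 2 (v - K.interp v) ∧
        K.dnorm 1 0 (v - K.interp v) ≤ C * (K.hx * K.dnorm 2 0 v + K.hy * K.dnorm 1 1 v) ∧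
        K.dnorm 0 1 (v - K.interp v) ≤ C * (K.hx * K.dnorm 1 1 v + K.hy * K.dnorm 0 2 v)) ∧
      (∀ v : ℝ × ℝ → ℝ, ReducedMorley.MemH K.inner 3 v →
        ReducedMorley.MemH K.inner 3 (v - K.interp v) ∧
        K.dnorm 1 0 (v - K.interp v) ≤
          C * (K.hx ^ 2 * K.dnorm 3 0 v + K.hx * K.hy * K.dnorm 2 1 v
            + K.hy ^ 2 * K.dnorm 1 2 v) ∧
        K.dnorm 0 1 (v - K.interp v) ≤
          C * (K.hx ^ 2 * K.dnorm 2 1 v + K.hx * K.hy * K.dnorm 1 2 v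
            + K.hy ^ 2 * K.dnorm 0 3 v) ∧
        K.dnorm 2 0 (v - K.interp v) ≤ C * (K.hx * K.dnorm 3 0 v + K.hy * K.dnorm 2 1 v) ∧
        K.dnorm 1 1 (v - K.interp v) ≤ C * (K.hx * K.dnorm 2 1 v + K.hy * K.dnorm 1 2 v) ∧
        K.dnorm 0 2 (v - K.interp v) ≤ C * (K.hx * K.dnorm 1 2 v + K.hy * K.dnorm 0 3 v)) := by
  refine ⟨160, by norm_num, fun K => ⟨fun v hv => ?_, fun v hv => ?_⟩⟩
  · have bound : ∀ i j, i + j ≤ 2 → ∀ h : ℝ, 0 < h → h * ReducedMorley.l2norm K.inner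
        (fun p => ReducedMorley.weakDeriv K.inner i j v p
          - K.mean (ReducedMorley.weakDeriv K.inner i j v)) ≤ 2 * (h * K.dnorm i j v) ∧
        0 ≤ h * K.dnorm i j v := fun i j hij h hh => by
      refine ⟨?_, mul_nonneg hh.le ReducedMorley.l2norm_nonneg⟩
      have := mul_le_mul_of_nonneg_left (ReducedMorley.Rect.l2norm_sub_mean_le
        (hv.memLp_weakDeriv K.isOpen_inner hij)) hh.le
      refine this.trans (le_of_eq ?_)
      rw [ReducedMorley.Rect.dnorm]; ring
    obtain ⟨h1, h2⟩ := ReducedMorley.Rect.dnorm_sub_interp_first hv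
    have b1 := bound 2 0 (by norm_num) _ K.hx_pos
    have b2 := bound 1 1 (by norm_num) _ K.hy_pos
    have b3 := bound 1 1 (by norm_num) _ K.hx_pos
    have b4 := bound 0 2 (by norm_num) _ K.hy_pos
    exact ⟨ReducedMorley.Rect.memH_sub_interp hv le_rfl, by linarith, by linarith⟩
  · have hv2 := hv.mono (l := 2) (by norm_num)
    have bound : ∀ i j, i + j ≤ 2 → ReducedMorley.l2norm K.inner
        (fun p => ReducedMorley.weakDeriv K.inner i j v p
          - K.mean (ReducedMorley.weakDeriv K.inner i j v))
          ≤ 8 * (K.hx * K.dnorm (i + 1) j v + K.hy * K.dnorm i (j + 1) v) := fun i j hij =>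
      (ReducedMorley.Rect.isH1_weakDeriv hv (by omega)).poincare
    have nonneg : ∀ h : ℝ, 0 < h → ∀ i j, 0 ≤ h * K.dnorm i j v := fun h hh i j =>
      mul_nonneg hh.le ReducedMorley.l2norm_nonneg
    have hx := K.hx_pos
    have hy := K.hy_pos
    obtain ⟨h1, h2⟩ := ReducedMorley.Rect.dnorm_sub_interp_first hv2
    have b1 := bound 2 0 (by norm_num)
    have b2 := bound 1 1 (by norm_num)
    have b3 := bound 0 2 (by norm_num)
    simp only [Nat.reduceAdd] at b1 b2 b3
    have b1x := mul_le_mul_of_nonneg_left b1 hx.le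
    have b2x := mul_le_mul_of_nonneg_left b2 hx.le
    have b2y := mul_le_mul_of_nonneg_left b2 hy.le
    have b3y := mul_le_mul_of_nonneg_left b3 hy.le
    have nxx := nonneg _ (pow_pos hx 2)
    have nyy := nonneg _ (pow_pos hy 2)
    have nxy := nonneg _ (mul_pos hx hy)
    have nx := nonneg _ hx
    have ny := nonneg _ hy
    refine ⟨ReducedMorley.Rect.memH_sub_interp hv (by norm_num), ?_, ?_, ?_, ?_, ?_⟩
    · refine h1.trans ?_
      linarith [nxx 3 0, nxy 2 1, nyy 1 2]
    · refine h2.trans ?_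
      linarith [nxx 2 1, nxy 1 2, nyy 0 3]
    · rw [ReducedMorley.Rect.dnorm_sub_interp_second hv2 (by norm_num)]
      linarith [nx 3 0, ny 2 1]
    · rw [ReducedMorley.Rect.dnorm_sub_interp_second hv2 (by norm_num)]
      linarith [nx 2 1, ny 1 2]
    · rw [ReducedMorley.Rect.dnorm_sub_interp_second hv2 (by norm_num)]
      linarith [nx 1 2, ny 0 3]
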